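/- Let $G$ be a finite group. For a finite group $H$ let $\mathrm{Irr}(H)$ be its set of irreducible complex characters, and for $X\subseteq\mathrm{Irr}(H)$ put $\sigma_X=\sum_{\chi\in X}\chi(1)\chi$. A supercharacter theory of $H$ is a pair $(\mathcal X,\mathcal K)$ where $\mathcal X$ is a partition of $\mathrm{Irr}(H)$, $\mathcal K$ is a partition of $H$ with $\{1\}\in\mathcal K$, $|\mathcal X|=|\mathcal K|$, and each $\sigma_X$ ($X\in\mathcal X$) is constant on each $K\in\mathcal K$; the members of $\mathcal K$ are the superclasses. Let $\mathrm{Sup}(H)$ be the set of supercharacter theories of $H$. Write $\mathcal P\preceq\mathcal Q$ if every part of the partition $\mathcal P$ lies in a part of the partition $\mathcal Q$. Order pairs by $(\mathcal X,\mathcal K)\preceq(\mathcal Y,\mathcal L)$ iff $\mathcal X\preceq\mathcal Y$ and $\mathcal K\preceq\mathcal L$, and put $(\mathcal X,\mathcal K)\vee(\mathcal Y,\mathcal L)=(\mathcal X\vee\mathcal Y,\mathcal K\vee\mathcal L)$, with joins taken in the partition lattices. Let $N\trianglelefteq G$. Identify $\mathrm{Irr}(G/N)$ by inflation with $\{\chi\in\mathrm{Irr}(G):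 N\subseteq\ker\chi\}$. Let $\varphi:G\to G/N$ be the projection. For $\psi\in\mathrm{Irr}(N)$ let $\mathrm{Irr}(G|\psi)=\{\chi\in\mathrm{Irr}(G):[\chi_N,\psi]>0\}$. For $X\subseteq\mathrm{Irr}(N)$ let $X^G=\bigcup_{\psi\in X}\mathrm{Irr}(G|\psi)$, and for $Z\subseteq\mathrm{Irr}(G)$ let $f(Z)$ be the set of irreducible constituents of the restrictions $\chi_N$, $\chi\in Z$. Let $\mathrm{Sup}_G(N)$ be the set of those members of $\mathrm{Sup}(N)$ whose superclasses are all invariant under conjugation by $G$. For $C=(\mathcal X,\mathcal K)\in\mathrm{Sup}_G(N)$ and $D=(\mathcal Y,\mathcal L)\in\mathrm{Sup}(G/N)$ the $*$-product over $N$ is $$C*_N D=\bigl(\mathcal Y\cup\{X^G: X\in\mathcal X,\ X\ne\{1_N\}\},\ \mathcal K\cup\{\varphi^{-1}(L): L\in\mathcal L,\ L\ne\{N\}\}\bigr).$$ A supercharacter theory $E$ of $G$ factors over $N$ if $E=C*_ND$ for some $C\in\mathrm{Sup}_G(N)$, $D\in\mathrm{Sup}(G/N)$; and $N$ is $E$-normal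 if $N$ is a union of superclasses of $E$. Let $m(H)$ be the theory whose superclasses are the conjugacy classes of $H$ and whose character parts are singletons, and let $M(H)$ be the theory whose superclasses are the nonempty sets among $\{1\}$, $H\setminus\{1\}$ and whose character parts are the nonempty sets among $\{1_H\}$, $\mathrm{Irr}(H)\setminus\{1_H\}$. Put $M(N\triangleleft G)=M(N)*_N M(G/N)$ and $m(N\triangleleft G)=\mathrm{Conj}_G(N)*_N m(G/N)$, where $\mathrm{Conj}_G(N)$ has as character parts the $G$-orbits on $\mathrm{Irr}(N)$ and as superclasses the $G$-conjugacy classes contained in $N$. For $E\in\mathrm{Sup}(G)$ write $E\vee m(N\triangleleft G)=(\mathcal Z,\mathcal M)$ and let $$E_N=\bigl(\{f(Z):Z\in\mathcal Z,\ Z\not\subseteq\mathrm{Irr}(G/N)\}\cup\{\{1_N\}\},\ \{M\in\mathcal M: M\subseteq N\}\bigr),$$ $$E^{G/N}=\bigl(\{Z\in\mathcal Z: Z\subseteq\mathrm{Irr}(G/N)\},\ \{\varphi(M): M\in\mathcal M,\ M\not\subseteq N\}\cup\{\{N\}\}\bigr).$$ Corollary. Let $G$ be a finite group, $N\trianglelefteq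 G$, and let $E$ be a supercharacter theory of $G$. (1) $E$ factors over $N$ if and only if $N$ is $E$-normal and every superclass of $E$ outside $N$ (that is, disjoint from $N$) is a union of $N$-cosets. (2) $E$ factors over $N$ if and only if $m(N\triangleleft G)\preceq E\preceq M(N\triangleleft G)$. (3) If $E=C*_ND$ with $C\in\mathrm{Sup}_G(N)$ and $D\in\mathrm{Sup}(G/N)$, then $C=E_N$ and $D=E^{G/N}$. Thus, if $E$ factors over $N$, then $E_N\in\mathrm{Sup}_G(N)$, $E^{G/N}\in\mathrm{Sup}(G/N)$ and $E=E_N*_NE^{G/N}$ is the only factorization of $E$ over $N$. -/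

import Mathlib

/-!
Supercharacter theories of finite groups, the star product, and the associated constructions.
-/

namespace Supercharacter

/-- `Irr G`: the irreducible complex characters of `G`, i.e. the functions `G → ℂ` which are
characters of irreducible finite-dimensional complex representations. -/
structure Irr (G : Type*) [Group G] where
  /-- the underlying function -/
  toFun : G → ℂ
  exists_rep : ∃ (n : ℕ) (ρ : Representation ℂ G (Fin n → ℂ)),
    ρ.IsIrreducible ∧ ρ.character = toFun

instance (G : Type*) [Group G] : CoeFun (Irr G) (fun _ => G → ℂ) := ⟨Irr.toFun⟩

@[ext] theorem Irr.ext {G : Type*} [Group G] {χ ψ : Irr G} (h : ∀ g, χ g = ψ g) : χ = ψ := by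
  cases χ; cases ψ; congr; exact funext h

/-- A finite group has finitely many irreducible characters (they are linearly independent), so
that the sums over sets of irreducible characters below are honest finite sums. -/
instance Irr.instFinite (G : Type*) [Group G] [Finite G] : Finite (Irr G) := by
  classical
  have := Fintype.ofFinite G
  have hc : (Nat.card G : ℂ) ≠ 0 := Nat.cast_ne_zero.2 Nat.card_pos.ne'
  have : Invertible (Nat.card G : ℂ) := invertibleOfNonzero hc
  have horth : ∀ χ ψ : Irr G,
      (Nat.card G : ℂ)⁻¹ * ∑ g : G, χ g * ψ g⁻¹ = if χ = ψ then 1 else 0 := by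
    rintro ⟨_, n, ρ, hρ, rfl⟩ ⟨_, m, σ, hσ, rfl⟩
    have h1 := Representation.char_orthonormal ρ σ
    have h2 := Representation.char_orthonormal ρ ρ
    rw [if_pos ⟨Representation.Equiv.refl ρ⟩] at h2
    show (Nat.card G : ℂ)⁻¹ * ∑ g : G, ρ.character g * σ.character g⁻¹ = _
    by_cases h : ρ.character = σ.character
    · rw [if_pos (Irr.ext (congrFun h)), ← h, h2]
    · rw [if_neg (fun h' => h (congrArg Irr.toFun h')), h1, if_neg]
      rintro ⟨e⟩
      exact h (Representation.char_iso e).symm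
  have hli : LinearIndependent ℂ (fun χ : Irr G => χ.toFun) := by
    rw [linearIndependent_iff']
    intro s c hs ψ hψ
    have h0 : (Nat.card G : ℂ)⁻¹ * ∑ g : G, (∑ χ ∈ s, c χ • χ.toFun) g * ψ g⁻¹ = 0 := by
      rw [hs]; simp
    have h1 : (Nat.card G : ℂ)⁻¹ * ∑ g : G, (∑ χ ∈ s, c χ • χ.toFun) g * ψ g⁻¹
        = ∑ χ ∈ s, c χ * ((Nat.card G : ℂ)⁻¹ * ∑ g : G, χ g * ψ g⁻¹) := by
      simp only [Finset.sum_apply, Pi.smul_apply, smul_eq_mul, Finset.sum_mul, Finset.mul_sum]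
      rw [Finset.sum_comm]
      refine Finset.sum_congr rfl fun χ _ => Finset.sum_congr rfl fun g _ => by ring
    rw [h1] at h0
    simp only [horth] at h0
    simpa [hψ] using h0
  exact hli.finite

/-- The set `{1_G}` whose only element is the trivial character of `G`. -/
def trivialIrr (G : Type*) [Group G] : Set (Irr G) := {χ | ∀ g, χ g = 1}

/-- `σ_X = ∑_{χ ∈ X} χ(1) χ`. -/
noncomputable def sigma {G : Type*} [Group G] (X : Set (Irr G)) (g : G) : ℂ :=
  ∑ᶠ χ ∈ X, χ 1 * χ g

/-- The usual inner product `[α, β] = |G|⁻¹ ∑_g α(g) conj(β(g))` of functions on a finite group. -/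
noncomputable def charInner {G : Type*} [Group G] (α β : G → ℂ) : ℂ :=
  (Nat.card G : ℂ)⁻¹ * ∑ᶠ g, α g * (starRingEnd ℂ) (β g)

/-- A pair consisting of a set of subsets of `Irr G` and a set of subsets of `G`. -/
@[ext] structure PartPair (G : Type*) [Group G] where
  /-- the family of sets of irreducible characters -/
  chars : Set (Set (Irr G))
  /-- the family of subsets of the group -/
  classes : Set (Set G)

/-- `(𝒳, 𝒦) ∈ Sup(G)`: `𝒳` is a partition of `Irr G`, `𝒦` is a partition of `G` with `{1} ∈ 𝒦`,
`|𝒳| = |𝒦|`, and every `σ_X`, `X ∈ 𝒳`, is constant on every `K ∈ 𝒦`. The members of `𝒦` are the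
superclasses. -/
structure PartPair.IsSupercharacterTheory {G : Type*} [Group G] (E : PartPair G) : Prop where
  chars_partition : Setoid.IsPartition E.chars
  classes_partition : Setoid.IsPartition E.classes
  one_mem : {1} ∈ E.classes
  card_eq : E.chars.ncard = E.classes.ncard
  sigma_const : ∀ X ∈ E.chars, ∀ K ∈ E.classes, ∀ g ∈ K, ∀ h ∈ K, sigma X g = sigma X h

/-- Refinement of partitions: every part of `P` lies inside a part of `Q`. -/
def Refines {α : Type*} (P Q : Set (Set α)) : Prop := ∀ A ∈ P, ∃ B ∈ Q, A ⊆ B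

/-- The order on supercharacter theories: refinement of both partitions. -/
instance (G : Type*) [Group G] : LE (PartPair G) :=
  ⟨fun C D => Refines C.chars D.chars ∧ Refines C.classes D.classes⟩

/-- The join of two partitions in the partition lattice: the classes of the equivalence relation
generated by lying in a common part of `P` or in a common part of `Q`. -/
def joinPartition {α : Type*} (P Q : Set (Set α)) : Set (Set α) :=
  (Relation.EqvGen.setoid (fun a b : α => ∃ A ∈ P ∪ Q, a ∈ A ∧ b ∈ A)).classes

/-- The join `(𝒳 ∨ 𝒴, 𝒦 ∨ ℒ)` of two supercharacter theories. -/
def PartPair.join {G : Type*} [Group G] (C D : PartPair G) : PartPair G where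
  chars := joinPartition C.chars D.chars
  classes := joinPartition C.classes D.classes

/-- The minimal supercharacter theory `m(G)`: ordinary characters and conjugacy classes. -/
def minTheory (G : Type*) [Group G] : PartPair G where
  chars := {X | ∃ χ : Irr G, X = {χ}}
  classes := {K | ∃ g : G, K = conjugatesOf g}

/-- The maximal supercharacter theory `M(G)`, with superclasses `{1}` and `G ∖ {1}`; the second one
is present only when it is nonempty, and likewise for the characters. -/
def maxTheory (G : Type*) [Group G] : PartPair G where
  chars := {X | (X = trivialIrr G ∨ X = (trivialIrr G)ᶜ) ∧ X.Nonempty}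
  classes := {K | (K = {1} ∨ K = {1}ᶜ) ∧ K.Nonempty}

/-- The supercharacter theory of `H` attached to an action `φ` of `G` on `H` by automorphisms: the
`G`-orbits on `Irr H`, and the finest partition of `H` into `G`-invariant unions of conjugacy
classes. -/
def conjTheory {G H : Type*} [Group G] [Group H] (φ : G →* MulAut H) : PartPair H where
  chars := {X | ∃ ψ : Irr H, X = {θ : Irr H | ∃ g : G, ∀ h, θ h = ψ (φ g h)}}
  classes := {K | ∃ h : H, K = {k | ∃ (g : G) (x : H), k = φ g (x * h * x⁻¹)}}

section Normal

variable {G : Type*} [Group G] (N : Subgroup G)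

/-- `Irr(G|ψ)`: the irreducible characters `χ` of `G` for which the multiplicity `[χ_N, ψ]` (a
nonnegative integer) is positive. -/
def irrOver (ψ : Irr N) : Set (Irr G) := {χ | charInner (fun n : N => χ (n : G)) ψ ≠ 0}

/-- `X^G`: the union of the sets `Irr(G|ψ)`, `ψ ∈ X`. -/
def induceSet (X : Set (Irr N)) : Set (Irr G) := ⋃ ψ ∈ X, irrOver N ψ

/-- `f(Z)`: the irreducible constituents of the restrictions to `N` of the characters in `Z`. -/
def constituents (Z : Set (Irr G)) : Set (Irr N) := {ψ | ∃ χ ∈ Z, χ ∈ irrOver N ψ}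

/-- `Irr(G/N)` as a subset of `Irr G`: the irreducible characters with `N` in their kernel. -/
def irrQuotient : Set (Irr G) := {χ | ∀ n ∈ N, χ n = χ 1}

variable [N.Normal]

/-- The set of characters of `G` obtained from a set of characters of `G/N` by inflation. -/
def inflateChars (Y : Set (Irr (G ⧸ N))) : Set (Irr G) :=
  {χ | ∃ ψ ∈ Y, ∀ g : G, χ g = ψ (g : G ⧸ N)}

/-- The set of characters of `G/N` whose inflations to `G` lie in a given set. -/
def deflateChars (Z : Set (Irr G)) : Set (Irr (G ⧸ N)) :=
  {ψ | ∃ χ ∈ Z, ∀ g : G, χ g = ψ (g : G ⧸ N)}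

variable {N} in
/-- A pair on `N` is `G`-invariant if conjugation by each element of `G` fixes each part of the
partition of `N` setwise. -/
def PartPair.IsInvariant (C : PartPair N) : Prop :=
  ∀ K ∈ C.classes, ∀ g : G, (fun n : N => MulAut.conjNormal g n) '' K = K

variable {N} in
/-- The star product of `C = (𝒳, 𝒦)` on `N` and `D = (𝒴, ℒ)` on `G/N`: the pair
`(𝒴 ∪ (𝒳 ∖ {{1_N}})^G, 𝒦 ∪ (ℒ ∖ {{N}})~)`, where `~` denotes the preimage in `G` and `Irr(G/N)` is
regarded as a subset of `Irr G` by inflation. -/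
def PartPair.starProduct (C : PartPair N) (D : PartPair (G ⧸ N)) : PartPair G where
  chars := inflateChars N '' D.chars ∪ induceSet N '' (C.chars \ {trivialIrr N})
  classes := (fun K : Set N => ((↑) : N → G) '' K) '' C.classes ∪
    (fun L : Set (G ⧸ N) => ((↑) : G → G ⧸ N) ⁻¹' L) '' (D.classes \ {{1}})

/-- `m(N ◁ G)`: the star product of the minimal `G`-invariant supercharacter theory of `N` with
`m(G/N)`. -/
def minNormal : PartPair G :=
  (conjTheory (MulAut.conjNormal : G →* MulAut N)).starProduct (minTheory (G ⧸ N))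

/-- `M(N ◁ G)`: the star product of `M(N)` with `M(G/N)`. -/
def maxNormal : PartPair G := (maxTheory N).starProduct (maxTheory (G ⧸ N))

/-- `E` factors over `N`: it is the star product of a `G`-invariant supercharacter theory of `N`
and a supercharacter theory of `G/N`. -/
def PartPair.FactorsOver (E : PartPair G) : Prop :=
  ∃ (C : PartPair N) (D : PartPair (G ⧸ N)), C.IsSupercharacterTheory ∧ C.IsInvariant ∧
    D.IsSupercharacterTheory ∧ E = C.starProduct D

/-- `E_N`, read off from `E ∨ m(N ◁ G)`. -/
def PartPair.restrict (E : PartPair G) : PartPair N where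
  chars := {X | ∃ Z ∈ (E.join (minNormal N)).chars, ¬ Z ⊆ irrQuotient N ∧ X = constituents N Z} ∪
    {trivialIrr N}
  classes := {K | ∃ M ∈ (E.join (minNormal N)).classes, M ⊆ (N : Set G) ∧
    K = ((↑) : N → G) ⁻¹' M}

/-- `E^{G/N}`, read off from `E ∨ m(N ◁ G)`. -/
def PartPair.quotient (E : PartPair G) : PartPair (G ⧸ N) where
  chars := {Y | ∃ Z ∈ (E.join (minNormal N)).chars, Z ⊆ irrQuotient N ∧ Y = deflateChars N Z}
  classes := {L | ∃ M ∈ (E.join (minNormal N)).classes, ¬ M ⊆ (N : Set G) ∧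
    L = ((↑) : G → G ⧸ N) '' M} ∪ {{1}}

end Normal

/-- `N` is `E`-normal: it is a union of superclasses of `E`. -/
def PartPair.IsNormalSubgroup {G : Type*} [Group G] (E : PartPair G) (N : Subgroup G) : Prop :=
  ∃ S ⊆ E.classes, (N : Set G) = ⋃₀ S

/-- `K` is a union of cosets of `N`. -/
def IsUnionOfCosets {G : Type*} [Group G] (N : Subgroup G) (K : Set G) : Prop :=
  ∃ T : Set (G ⧸ N), K = ((↑) : G → G ⧸ N) ⁻¹' T

end Supercharacter

open Supercharacter

/-!
Let `E = (𝒳, 𝒦)` be a supercharacter theory of `G`. The functions `σ_X` are linearly independent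
and there are as many of them as superclasses, so they span the superclass functions
(`exists_eq_sum_sigma`). Hence superclasses are closed under conjugation (`conj_mem`), `{1_G}` is
a part (`trivialIrr_mem`), and `[f, χ] / χ(1)` is constant on each part, for a superclass function
`f` (`charInner_mul_apply_one`).

A star product lies between `m(N ◁ G)` and `M(N ◁ G)` by these facts applied to the factors
(`minNormal_le_starProduct`, `starProduct_le_maxNormal`). In particular `E ∨ m(N ◁ G) = E` for a
star product `E`. By Clifford's theorem (`exists_eq_conj_of_resMult_ne_zero`) a `G`-invariant set
of characters of `N` consists of the constituents under `X^G`, so the factors can be read off from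
the product (`resPair_starProduct`, `quotPair_starProduct`), which is the uniqueness statement.
The bounds by `m(N ◁ G)` and `M(N ◁ G)` say on superclasses that `N` is a union of superclasses
and that the superclasses outside `N` are unions of cosets
(`isNormalSubgroup_and_isUnionOfCosets_of_le`).

It remains to factor `E` under this last condition (`factorsOver_of_isCompatible`). The indicator
function of `N` is a superclass function, so each part of `𝒳` lies inside `Irr(G/N)` or outside it
(`chars_subset_or_disjoint`). For a part `X` outside, the sums of `σ_X` over cosets of `N` vanish
while `σ_X` is constant on the cosets other than `N`; so `σ_X` vanishes off `N`
(`sigma_eq_zero_of_notMem`). Whether `χ` lies in `X` can therefore be decided on `N`, and `X` is a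
union of sets `Irr(G|ψ)` (`mem_of_resMult_ne_zero`). Consequently `X = f(X)^G`, and `σ_X`
restricts to `|G : N| σ_{f(X)}` on `N` (`sigma_induceSet`). This gives partitions with constant
`σ` on `N` and on `G/N` whose star product is `E`. Each of them has at most as many character
parts as superclasses (`ncard_chars_le_ncard_classes`), and since the two counts agree for `E`
they agree for both factors.

The character theory rests on Schur's lemma and on the completeness of the irreducible characters
(`eq_zero_of_forall_charInner_eq_zero`), a consequence of the semisimplicity of `ℂ[G]`.
-/

namespace Supercharacter

/-! ### Irreducible representations -/

section Representations

open scoped ComplexOrder Matrix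

variable {G : Type*} [Group G]

theorem isIrreducible_iff_forall_invariant {V : Type*} [AddCommGroup V] [Module ℂ V]
    (ρ : Representation ℂ G V) :
    ρ.IsIrreducible ↔ Nontrivial V ∧
      ∀ p : Submodule ℂ V, (∀ g, ∀ v ∈ p, ρ g v ∈ p) → p = ⊥ ∨ p = ⊤ := by
  have hbot : (⊥ : Subrepresentation ρ).toSubmodule = ⊥ := rfl
  have htop : (⊤ : Subrepresentation ρ).toSubmodule = ⊤ := rfl
  constructor
  · intro h
    refine ⟨?_, fun p hp => ?_⟩
    · rw [← Submodule.nontrivial_iff ℂ]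
      refine ⟨⊥, ⊤, fun hne => bot_ne_top (α := Subrepresentation ρ) ?_⟩
      exact Subrepresentation.toSubmodule_injective hne
    · rcases h.eq_bot_or_eq_top ⟨p, fun g v => hp g v⟩ with h | h
      · exact Or.inl (congrArg Subrepresentation.toSubmodule h)
      · exact Or.inr (congrArg Subrepresentation.toSubmodule h)
  · rintro ⟨hn, h⟩
    have : Nontrivial (Subrepresentation ρ) :=
      ⟨⊥, ⊤, fun hne => bot_ne_top (α := Submodule ℂ V)
        (congrArg Subrepresentation.toSubmodule hne)⟩
    refine ⟨fun p => ?_⟩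
    rcases h p.toSubmodule (fun g v hv => p.apply_mem_toSubmodule g hv) with h | h
    · exact Or.inl (Subrepresentation.toSubmodule_injective h)
    · exact Or.inr (Subrepresentation.toSubmodule_injective h)

theorem isIrreducible_comp {H V : Type*} [Group H] [AddCommGroup V] [Module ℂ V]
    {ρ : Representation ℂ H V} (hρ : ρ.IsIrreducible) {f : G →* H} (hf : Function.Surjective f) :
    Representation.IsIrreducible (ρ.comp f : Representation ℂ G V) := by
  rw [isIrreducible_iff_forall_invariant] at hρ ⊢
  refine ⟨hρ.1, fun p hp => hρ.2 p fun h v hv => ?_⟩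
  obtain ⟨g, rfl⟩ := hf h
  exact hp g v hv

/-- Schur's lemma over `ℂ`. -/
theorem exists_eq_smul_id_of_commute {n : ℕ} {ρ : Representation ℂ G (Fin n → ℂ)}
    (hρ : ρ.IsIrreducible) (T : (Fin n → ℂ) →ₗ[ℂ] (Fin n → ℂ))
    (hT : ∀ g, T ∘ₗ ρ g = ρ g ∘ₗ T) : ∃ c : ℂ, T = c • LinearMap.id := by
  obtain ⟨c, hc⟩ :=
    (Representation.IsIrreducible.algebraMap_intertwiningMap_bijective_of_isAlgClosed
      (ρ := ρ)).2 ⟨T, hT⟩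
  refine ⟨c, ?_⟩
  exact (congrArg (fun F => F.toLinearMap) hc).symm

/-- An irreducible representation is isomorphic to one on some `Fin n → ℂ`, the form required in
the definition of `Irr G`. -/
theorem exists_linearEquiv_conj_of_isIrreducible {V : Type*} [AddCommGroup V] [Module ℂ V]
    [FiniteDimensional ℂ V] {ρ : Representation ℂ G V} (hρ : ρ.IsIrreducible) :
    ∃ (n : ℕ) (σ : Representation ℂ G (Fin n → ℂ)) (e : V ≃ₗ[ℂ] (Fin n → ℂ)),
      σ.IsIrreducible ∧ ∀ g, σ g = e.conj (ρ g) := by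
  let e := (Module.finBasis ℂ V).equivFun
  let σ : Representation ℂ G (Fin (Module.finrank ℂ V) → ℂ) :=
    { toFun := fun g => e.conj (ρ g)
      map_one' := by simp [Module.End.one_eq_id]
      map_mul' := fun g h => by
        rw [map_mul, Module.End.mul_eq_comp, Module.End.mul_eq_comp, LinearEquiv.conj_comp] }
  refine ⟨_, σ, e, ?_, fun g => rfl⟩
  rw [isIrreducible_iff_forall_invariant] at hρ ⊢
  have := hρ.1
  refine ⟨e.symm.toEquiv.nontrivial, fun p hp => ?_⟩
  have hσ : ∀ g v, σ g (e v) = e (ρ g v) := fun g v => by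
    simp [σ, LinearEquiv.conj_apply]
  have hmap : (p.comap e.toLinearMap).map e.toLinearMap = p :=
    Submodule.map_comap_eq_of_surjective e.surjective p
  rcases hρ.2 (p.comap e.toLinearMap) (fun g v hv => by
    have := hp g _ hv
    simpa [hσ] using this) with h | h
  · left; rw [← hmap, h, Submodule.map_bot]
  · right; rw [← hmap, h, Submodule.map_top, LinearEquiv.range]

/-- A representation of a finite group preserves a positive definite form, obtained by averaging the
standard one; so `ρ g⁻¹` is similar to the conjugate transpose of `ρ g`. -/
theorem trace_inv_eq_conj [Fintype G] {n : ℕ} (ρ : Representation ℂ G (Fin n → ℂ)) (g : G) :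
    ρ.character g⁻¹ = (starRingEnd ℂ) (ρ.character g) := by
  classical
  let A : G → Matrix (Fin n) (Fin n) ℂ := fun g => LinearMap.toMatrix' (ρ g)
  have hA : ∀ g h, A (g * h) = A g * A h := fun g h => by
    simp only [A, map_mul, Module.End.mul_eq_comp, LinearMap.toMatrix'_comp]
  have hA1 : A 1 = 1 := by simp [A, Module.End.one_eq_id]
  have htr : ∀ g, ρ.character g = (A g).trace := fun g => by
    rw [Representation.character, ← Matrix.trace_toLin'_eq, Matrix.toLin'_toMatrix']
  have hAinv : ∀ g, A g⁻¹ * A g = 1 := fun g => by rw [← hA, inv_mul_cancel, hA1]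
  have hAinv' : ∀ g, A g * A g⁻¹ = 1 := fun g => by rw [← hA, mul_inv_cancel, hA1]
  let B : Matrix (Fin n) (Fin n) ℂ := ∑ h : G, (A h)ᴴ * A h
  have hB : B.PosDef := by
    refine Matrix.posDef_sum Finset.univ_nonempty fun h _ => ?_
    refine Matrix.PosDef.conjTranspose_mul_self _ fun v w hvw => ?_
    have := congrArg (fun u => (A h⁻¹).mulVec u) hvw
    simpa [Matrix.mulVec_mulVec, hAinv] using this
  have hBdet := (Matrix.isUnit_iff_isUnit_det _).1 hB.isUnit
  -- Invariance of the averaged form gives `(A g)ᴴ = B * (A g)⁻¹ * B⁻¹`; then take traces.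
  have hinv : (A g)ᴴ * B * A g = B := by
    simp only [B, Finset.mul_sum, Finset.sum_mul]
    refine Fintype.sum_equiv (Equiv.mulRight g) _ _ fun h => ?_
    simp only [Equiv.coe_mulRight, hA, Matrix.conjTranspose_mul, Matrix.mul_assoc]
  have hstar : (A g)ᴴ = B * A g⁻¹ * B⁻¹ := by
    have : (A g)ᴴ * B = B * A g⁻¹ := by
      calc (A g)ᴴ * B = ((A g)ᴴ * B * A g) * A g⁻¹ := by
            rw [Matrix.mul_assoc _ (A g), hAinv', Matrix.mul_one]
        _ = _ := by rw [hinv]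
    rw [← this, Matrix.mul_nonsing_inv_cancel_right _ _ hBdet]
  rw [htr, htr, starRingEnd_apply, ← Matrix.trace_conjTranspose, hstar, Matrix.trace_mul_comm,
    ← Matrix.mul_assoc, Matrix.nonsing_inv_mul _ hBdet, Matrix.one_mul]

/-- For a class function `a`, the element `∑ g, a g • g` of the group algebra is central, so it acts
on an irreducible representation as a scalar. -/
theorem exists_sum_smul_eq_smul_id [Fintype G] {n : ℕ} {ρ : Representation ℂ G (Fin n → ℂ)}
    (hρ : ρ.IsIrreducible) {a : G → ℂ} (ha : ∀ g h, a (h * g * h⁻¹) = a g) :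
    ∃ c : ℂ, ∑ g, a g • ρ g = c • LinearMap.id := by
  refine exists_eq_smul_id_of_commute hρ _ fun h => ?_
  change (∑ g, a g • ρ g) * ρ h = ρ h * ∑ g, a g • ρ g
  rw [Finset.sum_mul, Finset.mul_sum]
  refine Fintype.sum_equiv (MulAut.conj h⁻¹).toEquiv _ _ fun g => ?_
  have h1 : a (h⁻¹ * g * h) = a g := by simpa using ha g h⁻¹
  simp only [MulEquiv.toEquiv_eq_coe, MulEquiv.coe_toEquiv, MulAut.conj_apply, inv_inv, h1]
  rw [smul_mul_assoc, mul_smul_comm, ← map_mul, ← map_mul]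
  group

end Representations

/-! ### Irreducible characters -/

section Characters

variable {G : Type*} [Group G]

theorem Irr.conj_apply [Finite G] (χ : Irr G) (g : G) : (starRingEnd ℂ) (χ g) = χ g⁻¹ := by
  have := Fintype.ofFinite G
  obtain ⟨_, n, ρ, hρ, rfl⟩ := χ
  exact (trace_inv_eq_conj ρ g).symm

theorem Irr.apply_conj (χ : Irr G) (g h : G) : χ (h * g * h⁻¹) = χ g := by
  obtain ⟨_, n, ρ, hρ, rfl⟩ := χ
  exact ρ.char_conj g h

theorem Irr.apply_one_ne_zero (χ : Irr G) : χ 1 ≠ 0 := by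
  obtain ⟨_, n, ρ, hρ, rfl⟩ := χ
  have := ((isIrreducible_iff_forall_invariant ρ).1 hρ).1
  change ρ.character 1 ≠ 0
  rw [Representation.char_one]
  exact_mod_cast Module.finrank_pos.ne'

/-- If `a` is a class function, convolving `a` with `χ` multiplies `χ` by a scalar. -/
theorem Irr.sum_mul_apply_mul [Fintype G] (χ : Irr G) {a : G → ℂ}
    (ha : ∀ g h, a (h * g * h⁻¹) = a g) (h : G) :
    (∑ g, a g * χ (g * h)) * χ 1 = (∑ g, a g * χ g) * χ h := by
  obtain ⟨_, n, ρ, hρ, rfl⟩ := χ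
  obtain ⟨c, hc⟩ := exists_sum_smul_eq_smul_id hρ ha
  have key : ∀ h, ∑ g, a g * ρ.character (g * h) = c * ρ.character h := fun h => by
    have := congrArg (fun T => LinearMap.trace ℂ _ (T * ρ h)) hc
    simpa [Finset.sum_mul, Representation.character, ← Module.End.one_eq_id] using this
  have h1 := key 1
  simp only [mul_one] at h1
  change (∑ g, a g * ρ.character (g * h)) * ρ.character 1 =
    (∑ g, a g * ρ.character g) * ρ.character h
  rw [key, h1]
  ring

/-- The irreducible character of `G` obtained from an irreducible character of `H` along a
surjective homomorphism `G → H`. -/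
def Irr.comap {H : Type*} [Group H] (f : G →* H) (hf : Function.Surjective f) (ψ : Irr H) :
    Irr G where
  toFun g := ψ (f g)
  exists_rep := by
    obtain ⟨_, n, ρ, hρ, rfl⟩ := ψ
    exact ⟨n, ρ.comp f, isIrreducible_comp hρ hf, rfl⟩

/-- The trivial character as a member of `Irr G`. -/
def Irr.trivial (G : Type*) [Group G] : Irr G where
  toFun _ := 1
  exists_rep := by
    refine ⟨1, Representation.trivial ℂ G (Fin 1 → ℂ), ?_, ?_⟩
    · rw [isIrreducible_iff_forall_invariant]
      refine ⟨inferInstance, fun p _ => ?_⟩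
      have : IsSimpleOrder (Submodule ℂ (Fin 1 → ℂ)) :=
        is_simple_module_of_finrank_eq_one (A := ℂ) (V := Fin 1 → ℂ) (Module.finrank_fin_fun ℂ)
      exact eq_bot_or_eq_top p
    · ext g
      change LinearMap.trace ℂ (Fin 1 → ℂ) LinearMap.id = 1
      simp

@[simp] theorem Irr.trivial_apply (g : G) : Irr.trivial G g = 1 := rfl

theorem trivialIrr_eq_singleton : trivialIrr G = {Irr.trivial G} := by
  ext χ
  exact ⟨fun h => Irr.ext h, fun h g => by rw [Set.mem_singleton_iff.1 h]; rfl⟩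

theorem trivial_mem_trivialIrr : Irr.trivial G ∈ trivialIrr G := fun _ => rfl

theorem charInner_eq_sum [Fintype G] (f : G → ℂ) (χ : Irr G) :
    charInner f χ = (Nat.card G : ℂ)⁻¹ * ∑ g, f g * χ g⁻¹ := by
  simp only [charInner, finsum_eq_sum_of_fintype, Irr.conj_apply]

open scoped Classical in
theorem charInner_irr [Finite G] (χ ψ : Irr G) :
    charInner χ ψ = if χ = ψ then 1 else 0 := by
  have := Fintype.ofFinite G
  have hc : (Nat.card G : ℂ) ≠ 0 := Nat.cast_ne_zero.2 Nat.card_pos.ne'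
  have : Invertible (Nat.card G : ℂ) := invertibleOfNonzero hc
  rw [charInner_eq_sum]
  obtain ⟨_, n, ρ, hρ, rfl⟩ := χ
  obtain ⟨_, m, σ, hσ, rfl⟩ := ψ
  have h1 := Representation.char_orthonormal ρ σ
  have h2 := Representation.char_orthonormal ρ ρ
  rw [if_pos ⟨Representation.Equiv.refl ρ⟩] at h2
  change (Nat.card G : ℂ)⁻¹ * ∑ g : G, ρ.character g * σ.character g⁻¹ = _
  by_cases h : ρ.character = σ.character
  · rw [if_pos (Irr.ext (congrFun h)), ← h, h2]
  · rw [if_neg (fun h' => h (congrArg Irr.toFun h')), h1, if_neg]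
    rintro ⟨e⟩
    exact h (Representation.char_iso e).symm

theorem charInner_sum_mul [Finite G] {ι : Type*} (s : Finset ι) (c : ι → ℂ) (f : ι → G → ℂ)
    (β : G → ℂ) :
    charInner (fun g => ∑ i ∈ s, c i * f i g) β = ∑ i ∈ s, c i * charInner (f i) β := by
  have := Fintype.ofFinite G
  simp only [charInner, finsum_eq_sum_of_fintype, Finset.sum_mul, Finset.mul_sum]
  rw [Finset.sum_comm]
  exact Finset.sum_congr rfl fun i _ => Finset.sum_congr rfl fun g _ => by ring

theorem charInner_sub_mul [Finite G] (f g : G → ℂ) (a b : ℂ) (β : G → ℂ) :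
    charInner (fun x => a * f x - b * g x) β = a * charInner f β - b * charInner g β := by
  have := Fintype.ofFinite G
  simp only [charInner, finsum_eq_sum_of_fintype, Finset.mul_sum, ← Finset.sum_sub_distrib]
  exact Finset.sum_congr rfl fun g _ => by ring

/-- The irreducible characters span the class functions: a class function orthogonal to all of them
corresponds to an element of the group algebra annihilating every simple module, and the Jacobson
radical of the group algebra vanishes. -/
theorem eq_zero_of_forall_charInner_eq_zero [Finite G] {f : G → ℂ}
    (hf : ∀ g h, f (h * g * h⁻¹) = f g) (h0 : ∀ χ : Irr G, charInner f χ = 0) : f = 0 := by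
  have := Fintype.ofFinite G
  have hc : (Nat.card G : ℂ) ≠ 0 := Nat.cast_ne_zero.2 Nat.card_pos.ne'
  -- The inverse turns `∑ g, a g * χ g` into `|G|` times the inner product of `f` and `χ`.
  let a : G → ℂ := fun g => f g⁻¹
  have ha : ∀ g h, a (h * g * h⁻¹) = a g := fun g h => by
    simp only [a, ← hf g⁻¹ h]; congr 1; group
  let z : MonoidAlgebra ℂ G := ∑ g, MonoidAlgebra.single g (a g)
  have hirr : ∀ (n : ℕ) (σ : Representation ℂ G (Fin n → ℂ)), σ.IsIrreducible →
      ∑ g, a g • σ g = 0 := by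
    intro n σ hσ
    obtain ⟨c, hcσ⟩ := exists_sum_smul_eq_smul_id hσ ha
    let χ : Irr G := ⟨σ.character, n, σ, hσ, rfl⟩
    have h1 := h0 χ
    rw [charInner_eq_sum, mul_eq_zero, or_iff_right (inv_ne_zero hc)] at h1
    have h2 : ∑ g, a g * χ g = 0 := by
      rw [← h1]
      exact Fintype.sum_equiv (Equiv.inv G) _ _ fun g => by simp [a]
    have h3 := congrArg (LinearMap.trace ℂ _) hcσ
    rw [← Module.End.one_eq_id] at h3
    simp only [map_sum, map_smul, smul_eq_mul] at h3
    have h4 : c * χ 1 = 0 := by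
      rw [← h2, show χ 1 = LinearMap.trace ℂ _ (σ 1) from rfl, map_one, ← h3]
      rfl
    rw [hcσ, (mul_eq_zero.1 h4).resolve_right χ.apply_one_ne_zero, zero_smul]
  have hz : z ∈ Ring.jacobson (MonoidAlgebra ℂ G) := by
    refine Submodule.mem_sInf.2 fun I hI => ?_
    have hsimple := isSimpleModule_iff_isCoatom.2 hI
    let A : MonoidAlgebra ℂ G →ₐ[ℂ] Module.End ℂ (MonoidAlgebra ℂ G ⧸ I) :=
      Algebra.lsmul ℂ ℂ (MonoidAlgebra ℂ G ⧸ I)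
    let ρ : Representation ℂ G (MonoidAlgebra ℂ G ⧸ I) :=
      (A : MonoidAlgebra ℂ G →* _).comp (MonoidAlgebra.of ℂ G)
    have hρ : ρ.IsIrreducible := by
      rw [isIrreducible_iff_forall_invariant]
      refine ⟨IsSimpleModule.nontrivial (MonoidAlgebra ℂ G) _, fun p hp => ?_⟩
      let p' : Submodule (MonoidAlgebra ℂ G) (MonoidAlgebra ℂ G ⧸ I) :=
        { p with
          smul_mem' := fun c v hv => by
            induction c using MonoidAlgebra.induction_linear with
            | zero => rw [zero_smul]; exact p.zero_mem
            | add x y hx hy => rw [add_smul]; exact p.add_mem hx hy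
            | single g r =>
              have h1 : (MonoidAlgebra.single g r : MonoidAlgebra ℂ G) =
                  r • MonoidAlgebra.of ℂ G g := by simp
              rw [h1, smul_assoc]
              exact p.smul_mem r (hp g v hv) }
      have hmem : ∀ v, v ∈ p ↔ v ∈ p' := fun v => Iff.rfl
      rcases eq_bot_or_eq_top p' with h | h
      · left; ext v; rw [hmem, h, Submodule.mem_bot, Submodule.mem_bot]
      · right; ext v; simp [hmem, h]
    obtain ⟨n, σ, e, hσ, hσe⟩ := exists_linearEquiv_conj_of_isIrreducible hρ
    have h1 := hirr n σ hσ
    have hAz : A z = ∑ g, a g • ρ g := by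
      simp only [z, map_sum]
      refine Finset.sum_congr rfl fun g _ => ?_
      rw [show (MonoidAlgebra.single g (a g) : MonoidAlgebra ℂ G) =
        a g • MonoidAlgebra.of ℂ G g by simp, map_smul]
      rfl
    have h2 : e.conj (A z) = 0 := by
      rw [← h1, hAz]
      simp only [map_sum, map_smul, hσe]
    have h3 := (LinearEquiv.map_eq_zero_iff _).1 h2
    have h4 : z • (Submodule.Quotient.mk 1 : MonoidAlgebra ℂ G ⧸ I) = 0 :=
      congrArg (fun T => T (Submodule.Quotient.mk 1)) h3
    rwa [← Submodule.Quotient.mk_smul, Submodule.Quotient.mk_eq_zero, smul_eq_mul, mul_one] at h4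
  rw [IsSemisimpleRing.jacobson_eq_bot, Submodule.mem_bot] at hz
  have hcoef : ∀ g, a g = 0 := fun g => by
    have := congrArg (fun x => x.coeff g) hz
    classical
    simpa [z, MonoidAlgebra.coeff_single, Finsupp.single_apply] using this
  funext g
  simpa [a] using hcoef g⁻¹

/-- Every class function is the sum of its projections to the irreducible characters. -/
theorem eq_sum_charInner_mul [Finite G] [Fintype (Irr G)] {f : G → ℂ}
    (hf : ∀ g h, f (h * g * h⁻¹) = f g) (g : G) :
    f g = ∑ χ : Irr G, charInner f χ * χ g := by
  classical
  have h := eq_zero_of_forall_charInner_eq_zero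
    (f := fun g => 1 * f g - 1 * ∑ χ : Irr G, charInner f χ * χ g)
    (fun g h => by simp only [hf, Irr.apply_conj]) (fun ψ => by
      rw [charInner_sub_mul, charInner_sum_mul]
      simp [charInner_irr])
  have := congrFun h g
  simpa [sub_eq_zero] using this

theorem sigma_eq_sum [Fintype (Irr G)] (X : Set (Irr G)) [DecidablePred (· ∈ X)] (g : G) :
    sigma X g = ∑ χ : Irr G, (if χ ∈ X then χ 1 else 0) * χ g := by
  classical
  simp only [sigma, finsum_eq_sum_of_fintype]
  refine Finset.sum_congr rfl fun χ _ => ?_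
  by_cases h : χ ∈ X <;> simp [h]

open scoped Classical in
theorem charInner_sigma [Finite G] (X : Set (Irr G)) (χ : Irr G) :
    charInner (sigma X) χ = if χ ∈ X then χ 1 else 0 := by
  have := Fintype.ofFinite (Irr G)
  have h : sigma X = fun g => ∑ χ : Irr G, (if χ ∈ X then χ 1 else 0) * χ g :=
    funext fun g => sigma_eq_sum X g
  rw [h, charInner_sum_mul]
  simp [charInner_irr]

theorem sigma_apply_conj [Finite G] (X : Set (Irr G)) (g h : G) :
    sigma X (h * g * h⁻¹) = sigma X g := by
  simp only [sigma, Irr.apply_conj]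

end Characters

/-! ### Clifford theory for a normal subgroup -/

section Clifford

variable {G : Type*} [Group G] (N : Subgroup G)

/-- The multiplicity `[χ_N, ψ]` of `ψ` in the restriction of `χ` to `N`. -/
noncomputable def resMult (χ : Irr G) (ψ : Irr N) : ℂ := charInner (fun n : N => χ (n : G)) ψ

variable {N}

theorem mem_irrOver_iff {χ : Irr G} {ψ : Irr N} : χ ∈ irrOver N ψ ↔ resMult N χ ψ ≠ 0 := Iff.rfl

theorem mem_induceSet_iff {W : Set (Irr N)} {χ : Irr G} :
    χ ∈ induceSet N W ↔ ∃ ψ ∈ W, resMult N χ ψ ≠ 0 := by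
  simp [induceSet, mem_irrOver_iff]

theorem apply_eq_sum_resMult [Finite G] [Fintype (Irr N)] (χ : Irr G) (n : N) :
    χ (n : G) = ∑ θ : Irr N, resMult N χ θ * θ n :=
  eq_sum_charInner_mul (f := fun n : N => χ (n : G))
    (fun g h => by simpa using χ.apply_conj (g : G) h) n

theorem sum_extend_mul [Fintype G] [Fintype N] (f : N → ℂ) (c : G → ℂ) :
    ∑ x, Function.extend ((↑) : N → G) f 0 x * c x = ∑ n : N, f n * c n := by
  symm
  refine Fintype.sum_of_injective ((↑) : N → G) Subtype.val_injective _ _ (fun x hx => ?_)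
    fun n => ?_
  · rw [Function.extend_apply' _ _ _ hx, Pi.zero_apply, zero_mul]
  · rw [Subtype.val_injective.extend_apply]

theorem charInner_extend [Finite G] [Fintype N] (f : N → ℂ) (χ : Irr G) :
    charInner (Function.extend ((↑) : N → G) f 0) χ =
      (Nat.card G : ℂ)⁻¹ * ∑ n : N, f n * χ ((n⁻¹ : N) : G) := by
  have := Fintype.ofFinite G
  rw [charInner_eq_sum, sum_extend_mul f fun x => χ x⁻¹]
  rfl

theorem charInner_extend_one [Finite G] (χ : Irr G) :
    charInner (Function.extend ((↑) : N → G) (fun _ => (1 : ℂ)) 0) χ =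
      Nat.card N / Nat.card G * resMult N χ (Irr.trivial N) := by
  have := Fintype.ofFinite N
  have hcN : (Nat.card N : ℂ) ≠ 0 := Nat.cast_ne_zero.2 Nat.card_pos.ne'
  rw [charInner_extend, resMult, charInner_eq_sum]
  have h : ∑ n : N, (1 : ℂ) * χ ((n⁻¹ : N) : G) = ∑ n : N, χ (n : G) * Irr.trivial N n⁻¹ :=
    Fintype.sum_equiv (Equiv.inv N) _ _ fun n => by simp
  rw [h]
  field_simp

theorem exists_resMult_ne_zero [Finite G] (χ : Irr G) : ∃ ψ : Irr N, resMult N χ ψ ≠ 0 := by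
  have := Fintype.ofFinite (Irr N)
  by_contra! h
  refine χ.apply_one_ne_zero ?_
  rw [← Subgroup.coe_one N, apply_eq_sum_resMult]
  exact Finset.sum_eq_zero fun ψ _ => by rw [h, zero_mul]

theorem resMult_trivial_of_mem_irrQuotient [Finite G] {χ : Irr G} (hχ : χ ∈ irrQuotient N)
    (ψ : Irr N) : resMult N χ ψ ≠ 0 ↔ ψ ∈ trivialIrr N := by
  classical
  have h : resMult N χ ψ = χ 1 * charInner (Irr.trivial N) ψ := by
    have h0 := charInner_sub_mul (Irr.trivial N) (fun _ => 0) (χ 1) 0 ψ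
    simp only [zero_mul, sub_zero] at h0
    rw [← h0, resMult]
    congr 1
    funext n
    rw [hχ n n.2, Irr.trivial_apply, mul_one]
  rw [h, charInner_irr, trivialIrr_eq_singleton, Set.mem_singleton_iff, eq_comm (a := ψ)]
  have := χ.apply_one_ne_zero
  simp [this]

variable [N.Normal]

/-- The conjugate `n ↦ ψ (g n g⁻¹)` of a character of a normal subgroup. -/
def Irr.conj (g : G) (ψ : Irr N) : Irr N :=
  ψ.comap (MulAut.conjNormal g : MulAut N).toMonoidHom (MulAut.conjNormal g : MulAut N).surjective

theorem Irr.conj_apply_eq (g : G) (ψ : Irr N) (n : N) :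
    Irr.conj g ψ n = ψ (MulAut.conjNormal g n) := rfl

theorem Irr.conj_one (ψ : Irr N) : Irr.conj (1 : G) ψ = ψ :=
  Irr.ext fun n => by simp [Irr.conj_apply_eq]

theorem Irr.conj_conj (g h : G) (ψ : Irr N) : Irr.conj g (Irr.conj h ψ) = Irr.conj (h * g) ψ :=
  Irr.ext fun n => by simp [Irr.conj_apply_eq]

theorem Irr.conj_mem_trivialIrr_iff (g : G) (ψ : Irr N) :
    Irr.conj g ψ ∈ trivialIrr N ↔ ψ ∈ trivialIrr N := by
  refine ⟨fun h n => ?_, fun h n => h _⟩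
  have := h ((MulAut.conjNormal g)⁻¹ n)
  rwa [Irr.conj_apply_eq, MulAut.apply_inv_self] at this

/-- A set of characters of `N` which is invariant under conjugation by `G`. -/
def IsConjInvariant (W : Set (Irr N)) : Prop := ∀ ψ ∈ W, ∀ g : G, Irr.conj g ψ ∈ W

/-- The set of `G`-conjugates of a character of `N`. -/
def conjOrbit (ψ : Irr N) : Set (Irr N) := {θ | ∃ g : G, θ = Irr.conj g ψ}

theorem mem_conjOrbit_self (ψ : Irr N) : ψ ∈ conjOrbit ψ := ⟨1, (Irr.conj_one ψ).symm⟩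

theorem isConjInvariant_conjOrbit (ψ : Irr N) : IsConjInvariant (conjOrbit ψ) := by
  rintro _ ⟨g, rfl⟩ h
  exact ⟨g * h, Irr.conj_conj _ _ _⟩

theorem IsConjInvariant.conj_mem_iff {W : Set (Irr N)} (hW : IsConjInvariant W) (g : G)
    (ψ : Irr N) : Irr.conj g ψ ∈ W ↔ ψ ∈ W := by
  refine ⟨fun h => ?_, fun h => hW ψ h g⟩
  have := hW _ h g⁻¹
  rwa [Irr.conj_conj, mul_inv_cancel, Irr.conj_one] at this

theorem sigma_conjNormal [Finite G] {W : Set (Irr N)} (hW : IsConjInvariant W) (g : G) (n : N) :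
    sigma W (MulAut.conjNormal g n) = sigma W n := by
  classical
  have := Fintype.ofFinite (Irr N)
  rw [sigma_eq_sum, sigma_eq_sum]
  let e : Irr N ≃ Irr N :=
    { toFun := Irr.conj g
      invFun := Irr.conj g⁻¹
      left_inv := fun ψ => by rw [Irr.conj_conj, mul_inv_cancel, Irr.conj_one]
      right_inv := fun ψ => by rw [Irr.conj_conj, inv_mul_cancel, Irr.conj_one] }
  refine Fintype.sum_equiv e _ _ fun ψ => ?_
  simp only [e, Equiv.coe_fn_mk, hW.conj_mem_iff, Irr.conj_apply_eq, map_one]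

theorem charInner_conj [Finite G] {f : N → ℂ}
    (hf : ∀ (g : G) n, f (MulAut.conjNormal g n) = f n) (ψ : Irr N) (g : G) :
    charInner f (Irr.conj g ψ) = charInner f ψ := by
  have := Fintype.ofFinite N
  rw [charInner_eq_sum, charInner_eq_sum]
  congr 1
  refine Fintype.sum_equiv (MulAut.conjNormal g : MulAut N).toEquiv _ _ fun n => ?_
  simp only [MulEquiv.toEquiv_eq_coe, MulEquiv.coe_toEquiv, Irr.conj_apply_eq, map_inv, hf]

theorem resMult_conj [Finite G] (χ : Irr G) (ψ : Irr N) (g : G) :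
    resMult N χ (Irr.conj g ψ) = resMult N χ ψ :=
  charInner_conj (f := fun n : N => χ n)
    (fun g n => by rw [MulAut.conjNormal_apply, χ.apply_conj]) ψ g

theorem extend_conjNormal {f : N → ℂ} (hf : ∀ (g : G) n, f (MulAut.conjNormal g n) = f n)
    (x g : G) :
    Function.extend ((↑) : N → G) f 0 (g * x * g⁻¹) = Function.extend ((↑) : N → G) f 0 x := by
  by_cases hx : x ∈ N
  · rw [show x = ((⟨x, hx⟩ : N) : G) from rfl, ← MulAut.conjNormal_apply,
      Subtype.val_injective.extend_apply, Subtype.val_injective.extend_apply, hf]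
  · have hx' : g * x * g⁻¹ ∉ N := fun h => hx (by
      simpa [mul_assoc] using ‹N.Normal›.conj_mem _ h g⁻¹)
    rw [Function.extend_apply' _ _ x fun ⟨n, hn⟩ => hx (hn ▸ n.2),
      Function.extend_apply' _ _ (g * x * g⁻¹) fun ⟨n, hn⟩ => hx' (hn ▸ n.2), Pi.zero_apply,
      Pi.zero_apply]

/-- **Clifford's theorem**: the irreducible constituents of the restriction of an irreducible
character to a normal subgroup are conjugate. The idempotent of `ℂ[N]` belonging to a `G`-orbit on
`Irr N` is central in `ℂ[G]`, so it acts on the representation as a scalar; hence the orbit contains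
all the constituents as soon as it contains one of them. -/
theorem exists_eq_conj_of_resMult_ne_zero [Finite G] {χ : Irr G} {ψ θ : Irr N}
    (hψ : resMult N χ ψ ≠ 0) (hθ : resMult N χ θ ≠ 0) : ∃ g : G, θ = Irr.conj g ψ := by
  classical
  have := Fintype.ofFinite G
  have := Fintype.ofFinite N
  have hcN : (Nat.card N : ℂ) ≠ 0 := Nat.cast_ne_zero.2 Nat.card_pos.ne'
  -- Up to the factor `|N|`, the central idempotent of `ℂ[N]` attached to the orbit of `ψ`.
  let a : N → ℂ := fun n => sigma (conjOrbit ψ) n⁻¹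
  have ha : ∀ (g : G) n, a (MulAut.conjNormal g n) = a n := fun g n => by
    simp only [a, ← map_inv, sigma_conjNormal (isConjInvariant_conjOrbit ψ)]
  have haN : ∀ g h : N, a (h * g * h⁻¹) = a g := fun g h => by
    simp only [a, ← sigma_apply_conj (conjOrbit ψ) g⁻¹ h]; congr 1; group
  let F : N → ℂ := fun n => ∑ m : N, a m * χ ((m : G) * n)
  -- Convolution with `a` multiplies `χ_N` by a scalar, because `a` is central in `ℂ[G]`.
  obtain ⟨ω, hω⟩ : ∃ ω : ℂ, ∀ n : N, F n * χ 1 = ω * χ n :=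
    ⟨_, fun n => by
      simp only [F]
      rw [← sum_extend_mul a fun x => χ (x * n)]
      exact χ.sum_mul_apply_mul (fun x g => extend_conjNormal ha x g) (n : G)⟩
  -- Computed inside `N`, the same convolution projects to the constituents in the orbit.
  have hF : ∀ η : Irr N, charInner F η =
      (if η ∈ conjOrbit ψ then (Nat.card N : ℂ) else 0) * resMult N χ η := by
    intro η
    have hη := η.apply_one_ne_zero
    have h1 : ∑ m, a m * η m = Nat.card N * if η ∈ conjOrbit ψ then η 1 else 0 := by
      rw [← charInner_sigma, charInner_eq_sum, mul_inv_cancel_left₀ hcN]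
      exact Fintype.sum_equiv (Equiv.inv N) _ _ fun m => by simp [a]
    have h2 : ∀ k : N, ∑ m, a m * η (m * k) =
        (if η ∈ conjOrbit ψ then (Nat.card N : ℂ) else 0) * η k := fun k => by
      have h := η.sum_mul_apply_mul haN k
      rw [h1] at h
      apply mul_right_cancel₀ hη
      rw [h]
      split_ifs <;> ring
    rw [resMult, charInner_eq_sum, charInner_eq_sum, mul_left_comm]
    congr 1
    rw [Finset.mul_sum]
    simp only [F, Finset.sum_mul]
    rw [Finset.sum_comm]
    have h3 : ∀ m : N, ∑ n : N, a m * χ ((m : G) * n) * η n⁻¹ =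
        ∑ k : N, χ (k : G) * (a m * η (m * k⁻¹)) := fun m => by
      refine Fintype.sum_equiv (Equiv.mulLeft m) _ _ fun n => ?_
      simp only [Equiv.coe_mulLeft, Subgroup.coe_mul]
      rw [← η.apply_conj n⁻¹ m, mul_inv_rev, mul_assoc m]
      ring
    simp only [h3]
    rw [Finset.sum_comm]
    refine Finset.sum_congr rfl fun k _ => ?_
    rw [← Finset.mul_sum, h2]
    ring
  have hscal : ∀ η : Irr N, χ 1 * charInner F η = ω * resMult N χ η := fun η => by
    have h := charInner_sub_mul F (fun n : N => χ n) (χ 1) ω η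
    have h0 : (fun n : N => χ 1 * F n - ω * χ n) = fun _ => 0 := by
      funext n; rw [← hω n]; ring
    rw [h0] at h
    rw [← sub_eq_zero, resMult, ← h]
    simp [charInner]
  by_contra hne
  change θ ∉ conjOrbit ψ at hne
  have h1 := hscal θ
  have h2 := hscal ψ
  rw [hF, if_neg hne, zero_mul, mul_zero, eq_comm, mul_eq_zero, or_iff_left hθ] at h1
  rw [hF, if_pos (mem_conjOrbit_self ψ), h1, zero_mul] at h2
  exact mul_ne_zero χ.apply_one_ne_zero (mul_ne_zero hcN hψ) h2

/-- Two characters of `G` over the same character of `N` have proportional restrictions to `N`. -/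
theorem resMult_mul_apply_eq [Finite G] {χ χ' : Irr G} {ψ : Irr N}
    (h : resMult N χ ψ ≠ 0) (h' : resMult N χ' ψ ≠ 0) (n : N) :
    resMult N χ' ψ * χ n = resMult N χ ψ * χ' n := by
  have := Fintype.ofFinite (Irr N)
  rw [apply_eq_sum_resMult χ n, apply_eq_sum_resMult χ' n, Finset.mul_sum, Finset.mul_sum]
  refine Finset.sum_congr rfl fun θ _ => ?_
  by_cases hθ : θ ∈ conjOrbit ψ
  · obtain ⟨g, rfl⟩ := hθ
    rw [resMult_conj, resMult_conj]
    ring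
  · have h1 : resMult N χ θ = 0 := by
      by_contra h1; exact hθ (exists_eq_conj_of_resMult_ne_zero h h1)
    have h2 : resMult N χ' θ = 0 := by
      by_contra h2; exact hθ (exists_eq_conj_of_resMult_ne_zero h' h2)
    rw [h1, h2]
    ring

/-- For a `G`-invariant set `W` of characters of `N`, the function `σ_{W^G}` vanishes off `N` and
is `|G : N| σ_W` on `N`. Both sides have inner product `∑ θ ∈ W, [χ_N, θ] θ(1)` with `χ`, and by
Clifford's theorem this is `χ(1)` or `0` according as `χ` lies in `W^G` or not. -/
theorem sigma_induceSet [Finite G] {W : Set (Irr N)} (hW : IsConjInvariant W) (x : G) :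
    sigma (induceSet N W) x =
      Nat.card G / Nat.card N * Function.extend ((↑) : N → G) (sigma W) 0 x := by
  classical
  have := Fintype.ofFinite G
  have := Fintype.ofFinite N
  have := Fintype.ofFinite (Irr N)
  have hcN : (Nat.card N : ℂ) ≠ 0 := Nat.cast_ne_zero.2 Nat.card_pos.ne'
  have hcG : (Nat.card G : ℂ) ≠ 0 := Nat.cast_ne_zero.2 Nat.card_pos.ne'
  have hext := extend_conjNormal fun g n => sigma_conjNormal hW g n
  have hinner : ∀ χ : Irr G, Nat.card G / Nat.card N *
      charInner (Function.extend ((↑) : N → G) (sigma W) 0) χ =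
        ∑ θ : Irr N, resMult N χ θ * if θ ∈ W then θ 1 else 0 := fun χ => by
    rw [charInner_eq_sum, sum_extend_mul (sigma W) fun x => χ x⁻¹]
    simp only [← charInner_sigma]
    simp only [charInner_eq_sum, Finset.mul_sum]
    rw [Finset.sum_comm]
    refine Finset.sum_congr rfl fun n _ => ?_
    rw [← Subgroup.coe_inv, apply_eq_sum_resMult, Finset.mul_sum, Finset.mul_sum, Finset.mul_sum]
    refine Finset.sum_congr rfl fun θ _ => ?_
    field_simp
  have h0 := eq_zero_of_forall_charInner_eq_zero
    (f := fun x => 1 * sigma (induceSet N W) x -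
      Nat.card G / Nat.card N * Function.extend ((↑) : N → G) (sigma W) 0 x)
    (fun g h => by simp only [hext, sigma_apply_conj]) (fun χ => by
      rw [charInner_sub_mul, one_mul, charInner_sigma, hinner, sub_eq_zero]
      split_ifs with hχ
      · rw [mem_induceSet_iff] at hχ
        obtain ⟨ψ, hψ, hχψ⟩ := hχ
        have h1 := apply_eq_sum_resMult χ (1 : N)
        rw [Subgroup.coe_one] at h1
        rw [h1]
        refine Finset.sum_congr rfl fun θ _ => ?_
        by_cases hθ : resMult N χ θ = 0
        · rw [hθ, zero_mul, zero_mul]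
        · obtain ⟨g, rfl⟩ := exists_eq_conj_of_resMult_ne_zero hχψ hθ
          rw [if_pos (hW ψ hψ g)]
      · refine (Finset.sum_eq_zero fun θ _ => ?_).symm
        split_ifs with hθ
        · rw [mem_induceSet_iff] at hχ
          push Not at hχ
          rw [hχ θ hθ, zero_mul]
        · rw [mul_zero])
  have := congrFun h0 x
  simpa [sub_eq_zero] using this

/-- Every irreducible character of `N` lies under some irreducible character of `G`; otherwise
`σ_{O^G}` would vanish for its orbit `O`. -/
theorem irrOver_nonempty [Finite G] (ψ : Irr N) : ∃ χ : Irr G, resMult N χ ψ ≠ 0 := by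
  classical
  by_contra! h
  have hempty : induceSet N (conjOrbit ψ) = ∅ := by
    refine Set.eq_empty_of_forall_notMem fun χ hχ => ?_
    obtain ⟨_, ⟨g, rfl⟩, hne⟩ := mem_induceSet_iff.1 hχ
    rw [resMult_conj] at hne
    exact hne (h χ)
  have hcN : (Nat.card N : ℂ) ≠ 0 := Nat.cast_ne_zero.2 Nat.card_pos.ne'
  have hcG : (Nat.card G : ℂ) ≠ 0 := Nat.cast_ne_zero.2 Nat.card_pos.ne'
  have hzero : sigma (conjOrbit ψ) = fun _ => 0 := funext fun n => by
    have h1 := sigma_induceSet (isConjInvariant_conjOrbit ψ) (n : G)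
    rw [hempty, Subtype.val_injective.extend_apply] at h1
    simpa [sigma, hcN, hcG] using h1
  have h2 := charInner_sigma (conjOrbit ψ) ψ
  rw [hzero, if_pos (mem_conjOrbit_self ψ)] at h2
  exact ψ.apply_one_ne_zero (by rw [← h2]; simp [charInner])

theorem mem_irrQuotient_iff_resMult_trivial [Finite G] {χ : Irr G} :
    χ ∈ irrQuotient N ↔ resMult N χ (Irr.trivial N) ≠ 0 := by
  refine ⟨fun h => (resMult_trivial_of_mem_irrQuotient h _).2 trivial_mem_trivialIrr,
    fun h n hn => ?_⟩
  have := Fintype.ofFinite (Irr N)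
  have h1 := apply_eq_sum_resMult χ (⟨n, hn⟩ : N)
  have h2 := apply_eq_sum_resMult χ (1 : N)
  rw [Subgroup.coe_one] at h2
  change χ n = _ at h1
  rw [h1, h2]
  refine Finset.sum_congr rfl fun θ _ => ?_
  by_cases hθ : resMult N χ θ = 0
  · rw [hθ, zero_mul, zero_mul]
  · obtain ⟨g, rfl⟩ := exists_eq_conj_of_resMult_ne_zero h hθ
    rfl

theorem mem_irrQuotient_iff_of_resMult_ne_zero [Finite G] {χ : Irr G} {ψ : Irr N}
    (h : resMult N χ ψ ≠ 0) : χ ∈ irrQuotient N ↔ ψ ∈ trivialIrr N := by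
  refine ⟨fun hχ => (resMult_trivial_of_mem_irrQuotient hχ ψ).1 h, fun hψ => ?_⟩
  rw [trivialIrr_eq_singleton, Set.mem_singleton_iff] at hψ
  rw [mem_irrQuotient_iff_resMult_trivial, ← hψ]
  exact h

theorem constituents_induceSet [Finite G] {W : Set (Irr N)} (hW : IsConjInvariant W) :
    constituents N (induceSet N W) = W := by
  ext ψ
  constructor
  · rintro ⟨χ, hχ, hχψ⟩
    obtain ⟨θ, hθ, hχθ⟩ := mem_induceSet_iff.1 hχ
    obtain ⟨g, rfl⟩ := exists_eq_conj_of_resMult_ne_zero hχθ hχψ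
    exact hW θ hθ g
  · intro hψ
    obtain ⟨χ, hχ⟩ := irrOver_nonempty (G := G) ψ
    exact ⟨χ, mem_induceSet_iff.2 ⟨ψ, hψ, hχ⟩, hχ⟩

/-! ### Inflation -/

/-- Inflation of characters of `G ⧸ N` to `G`. -/
def Irr.inflate (ψ : Irr (G ⧸ N)) : Irr G :=
  ψ.comap (QuotientGroup.mk' N) (QuotientGroup.mk'_surjective N)

@[simp] theorem Irr.inflate_apply (ψ : Irr (G ⧸ N)) (g : G) :
    ψ.inflate g = ψ (g : G ⧸ N) := rfl

theorem inflate_injective : Function.Injective (Irr.inflate (N := N)) := by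
  intro ψ θ h
  refine Irr.ext fun x => ?_
  obtain ⟨g, rfl⟩ := QuotientGroup.mk_surjective x
  rw [← Irr.inflate_apply, h, Irr.inflate_apply]

theorem inflateChars_eq_image (Y : Set (Irr (G ⧸ N))) :
    inflateChars N Y = Irr.inflate '' Y := by
  ext χ
  constructor
  · rintro ⟨ψ, hψ, h⟩
    exact ⟨ψ, hψ, Irr.ext fun g => (h g).symm⟩
  · rintro ⟨ψ, hψ, rfl⟩
    exact ⟨ψ, hψ, fun g => rfl⟩

theorem deflateChars_eq_preimage (Z : Set (Irr G)) :
    deflateChars N Z = Irr.inflate ⁻¹' Z := by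
  ext ψ
  constructor
  · rintro ⟨χ, hχ, h⟩
    have : ψ.inflate = χ := Irr.ext fun g => (h g).symm
    rwa [Set.mem_preimage, this]
  · intro h
    exact ⟨_, h, fun g => rfl⟩

theorem inflate_mem_irrQuotient (ψ : Irr (G ⧸ N)) : ψ.inflate ∈ irrQuotient N := by
  intro n hn
  rw [Irr.inflate_apply, Irr.inflate_apply, (QuotientGroup.eq_one_iff n).2 hn]
  rfl

/-- A character with `N` in its kernel is inflated from the quotient: `∑ n ∈ N, ρ n` is a scalar,
of trace `|N| χ(1)`, hence equal to `|N|`, and it is absorbed by each `ρ n`. -/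
theorem range_inflate [Finite G] : Set.range (Irr.inflate (N := N)) = irrQuotient N := by
  apply Set.Subset.antisymm
  · rintro _ ⟨ψ, rfl⟩
    exact inflate_mem_irrQuotient ψ
  intro χ hχ
  have := Fintype.ofFinite G
  have := Fintype.ofFinite N
  have hcN : (Nat.card N : ℂ) ≠ 0 := Nat.cast_ne_zero.2 Nat.card_pos.ne'
  have h1 := χ.apply_one_ne_zero
  obtain ⟨_, d, ρ, hρ, rfl⟩ := χ
  have h1 : ρ.character 1 ≠ 0 := h1
  have hχ : ∀ n ∈ N, ρ.character n = ρ.character 1 := hχ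
  obtain ⟨c, hc⟩ : ∃ c : ℂ, ∑ n : N, ρ (n : G) = c • LinearMap.id := by
    refine exists_eq_smul_id_of_commute hρ _ fun h => ?_
    change (∑ n : N, ρ (n : G)) * ρ h = ρ h * ∑ n : N, ρ (n : G)
    rw [Finset.sum_mul, Finset.mul_sum]
    refine Fintype.sum_equiv (MulAut.conjNormal h⁻¹ : MulAut N).toEquiv _ _ fun n => ?_
    simp only [MulEquiv.toEquiv_eq_coe, MulEquiv.coe_toEquiv, MulAut.conjNormal_apply, ← map_mul]
    group
  have hcN' : c = Nat.card N := by
    have h := congrArg (LinearMap.trace ℂ _) hc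
    rw [← Module.End.one_eq_id, ← map_one ρ] at h
    simp only [map_sum, map_smul, smul_eq_mul] at h
    apply mul_right_cancel₀ h1
    change c * LinearMap.trace ℂ _ (ρ 1) = _
    have h2 : ∑ n : N, LinearMap.trace ℂ _ (ρ (n : G)) = ∑ _n : N, ρ.character 1 :=
      Finset.sum_congr rfl fun n _ => hχ n n.2
    rw [← h, h2]
    simp [Nat.card_eq_fintype_card]
  have hker : N ≤ MonoidHom.ker ρ := by
    intro n hn
    rw [MonoidHom.mem_ker]
    have h : ρ n * ∑ m : N, ρ (m : G) = ∑ m : N, ρ (m : G) := by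
      rw [Finset.mul_sum]
      refine Fintype.sum_equiv (Equiv.mulLeft (⟨n, hn⟩ : N)) _ _ fun m => ?_
      rw [← map_mul]; rfl
    rw [hc, hcN', ← Module.End.one_eq_id, mul_smul_comm, mul_one] at h
    exact smul_right_injective _ hcN h
  let σ : Representation ℂ (G ⧸ N) (Fin d → ℂ) := QuotientGroup.lift N ρ hker
  have hσ : ∀ g : G, σ (g : G ⧸ N) = ρ g := fun g => rfl
  have hσirr : σ.IsIrreducible := by
    rw [isIrreducible_iff_forall_invariant] at hρ ⊢
    exact ⟨hρ.1, fun p hp => hρ.2 p fun g v hv => by rw [← hσ]; exact hp g v hv⟩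
  exact ⟨⟨σ.character, d, σ, hσirr, rfl⟩, Irr.ext fun g => rfl⟩

theorem sigma_inflate (Y : Set (Irr (G ⧸ N))) (g : G) :
    sigma (Irr.inflate '' Y) g = sigma Y (g : G ⧸ N) := by
  rw [sigma, sigma, finsum_mem_image inflate_injective.injOn]
  rfl

end Clifford

/-! ### Partitions -/

section Partitions

variable {α : Type*}

theorem isPartition_of_forall {P : Set (Set α)} (hne : ∀ A ∈ P, A.Nonempty)
    (hcov : ∀ a, ∃ A ∈ P, a ∈ A) (heq : ∀ A ∈ P, ∀ B ∈ P, ∀ a, a ∈ A → a ∈ B → A = B) :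
    Setoid.IsPartition P := by
  refine ⟨fun h => Set.not_nonempty_empty (hne _ h), fun a => ?_⟩
  obtain ⟨A, hA, ha⟩ := hcov a
  exact ⟨A, ⟨hA, ha⟩, fun B ⟨hB, hb⟩ => heq B hB A hA a hb ha⟩

theorem eq_of_mem_of_mem {P : Set (Set α)} (hP : Setoid.IsPartition P) {A B : Set α}
    (hA : A ∈ P) (hB : B ∈ P) {a : α} (ha : a ∈ A) (hb : a ∈ B) : A = B :=
  Setoid.eq_of_mem_eqv_class hP.2 hA ha hB hb

theorem exists_mem_part {P : Set (Set α)} (hP : Setoid.IsPartition P) (a : α) :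
    ∃ A ∈ P, a ∈ A :=
  (hP.2 a).exists

theorem joinPartition_eq_left {P Q : Set (Set α)} (hP : Setoid.IsPartition P)
    (hQ : Refines Q P) : joinPartition P Q = P := by
  have h : Relation.EqvGen.setoid (fun a b : α => ∃ A ∈ P ∪ Q, a ∈ A ∧ b ∈ A) =
      Setoid.mkClasses P hP.2 := by
    apply le_antisymm
    · refine Setoid.eqvGen_le ?_
      rintro a b ⟨A, hA | hA, ha, hb⟩ B hB haB
      · rwa [eq_of_mem_of_mem hP hB hA haB ha]
      · obtain ⟨B', hB', hAB⟩ := hQ A hA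
        rw [eq_of_mem_of_mem hP hB hB' haB (hAB ha)]
        exact hAB hb
    · intro a b hab
      obtain ⟨A, hA, ha⟩ := exists_mem_part hP a
      exact Relation.EqvGen.rel _ _ ⟨A, Or.inl hA, ha, hab A hA ha⟩
  rw [joinPartition, h, Setoid.classes_mkClasses P hP]

theorem PartPair.join_eq_left {G : Type*} [Group G] {E F : PartPair G}
    (hE : E.IsSupercharacterTheory) (hF : F ≤ E) : E.join F = E :=
  PartPair.ext (joinPartition_eq_left hE.chars_partition hF.1)
    (joinPartition_eq_left hE.classes_partition hF.2)

end Partitions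

/-! ### Superclass functions -/

section Superclass

/-- The functions which are constant on each member of `𝒦`. -/
def constOn {α : Type*} (𝒦 : Set (Set α)) : Submodule ℂ (α → ℂ) where
  carrier := {f | ∀ K ∈ 𝒦, ∀ g ∈ K, ∀ h ∈ K, f g = f h}
  add_mem' := fun {a b} ha hb K hK g hg h hh => by
    rw [Pi.add_apply, Pi.add_apply, ha K hK g hg h hh, hb K hK g hg h hh]
  zero_mem' := fun _ _ _ _ _ _ => rfl
  smul_mem' := fun c f hf K hK g hg h hh => by
    rw [Pi.smul_apply, Pi.smul_apply, hf K hK g hg h hh]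

theorem finrank_constOn_le {α : Type*} [Finite α] {𝒦 : Set (Set α)} (h𝒦 : Setoid.IsPartition 𝒦) :
    Module.finrank ℂ (constOn 𝒦) ≤ 𝒦.ncard := by
  have := Fintype.ofFinite 𝒦
  have hne : ∀ K : 𝒦, (K : Set α).Nonempty := fun K => Setoid.nonempty_of_mem_partition h𝒦 K.2
  choose r hr using hne
  let T : constOn 𝒦 →ₗ[ℂ] (𝒦 → ℂ) :=
    { toFun := fun f K => (f : α → ℂ) (r K)
      map_add' := fun _ _ => rfl
      map_smul' := fun _ _ => rfl }
  have hT : Function.Injective T := fun f f' h => by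
    ext g
    obtain ⟨K, hK, hg⟩ := exists_mem_part h𝒦 g
    rw [f.2 K hK g hg _ (hr ⟨K, hK⟩), f'.2 K hK g hg _ (hr ⟨K, hK⟩)]
    exact congrFun h ⟨K, hK⟩
  have := LinearMap.finrank_le_finrank_of_injective hT
  rwa [Module.finrank_fintype_fun_eq_card, ← Nat.card_eq_fintype_card] at this

variable {G : Type*} [Group G]

/-- Distinct parts involve disjoint sets of irreducible characters. -/
theorem linearIndependent_sigma [Finite G] {𝒳 : Set (Set (Irr G))}
    (h𝒳 : Setoid.IsPartition 𝒳) : LinearIndependent ℂ (fun X : 𝒳 => sigma (X : Set (Irr G))) := by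
  classical
  rw [linearIndependent_iff']
  intro s c hs X hX
  obtain ⟨χ, hχ⟩ := Setoid.nonempty_of_mem_partition h𝒳 X.2
  have h1 := charInner_sum_mul s c (fun Y : 𝒳 => sigma (Y : Set (Irr G))) χ
  have h0 : (fun g => ∑ Y ∈ s, c Y * sigma (Y : Set (Irr G)) g) = fun _ => 0 := by
    rw [← Pi.zero_def, ← hs]; ext g; simp
  have h2 : ∀ Y : 𝒳, χ ∈ (Y : Set (Irr G)) ↔ Y = X := fun Y =>
    ⟨fun h => Subtype.ext (eq_of_mem_of_mem h𝒳 Y.2 X.2 h hχ), fun h => h ▸ hχ⟩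
  rw [h0] at h1
  simp only [charInner_sigma, h2, mul_ite, mul_zero, Finset.sum_ite_eq', hX, if_true] at h1
  have h3 : charInner (fun _ : G => (0 : ℂ)) χ = 0 := by simp [charInner]
  rw [h3] at h1
  exact (mul_eq_zero.1 h1.symm).resolve_right χ.apply_one_ne_zero

theorem ncard_chars_le_ncard_classes [Finite G] {E : PartPair G}
    (hX : Setoid.IsPartition E.chars) (hK : Setoid.IsPartition E.classes)
    (hσ : ∀ X ∈ E.chars, sigma X ∈ constOn E.classes) : E.chars.ncard ≤ E.classes.ncard := by
  have := Fintype.ofFinite E.chars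
  have hli : LinearIndependent ℂ (fun X : E.chars => (⟨sigma X, hσ X X.2⟩ : constOn E.classes)) :=
    LinearIndependent.of_comp (constOn E.classes).subtype (linearIndependent_sigma hX)
  have := hli.fintype_card_le_finrank
  rw [← Nat.card_eq_fintype_card] at this
  exact this.trans (finrank_constOn_le hK)

namespace PartPair.IsSupercharacterTheory


/-- The functions `σ_X` span the superclass functions: they are linearly independent, and there are
as many of them as there are superclasses. -/
theorem exists_eq_sum_sigma [Finite G] {E : PartPair G} (hE : E.IsSupercharacterTheory)
    [Fintype E.chars] {f : G → ℂ} (hf : f ∈ constOn E.classes) :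
    ∃ c : E.chars → ℂ, f = fun g => ∑ X : E.chars, c X * sigma (X : Set (Irr G)) g := by
  let v : E.chars → constOn E.classes := fun X => ⟨sigma X, fun K hK => hE.sigma_const X X.2 K hK⟩
  have hli : LinearIndependent ℂ v :=
    LinearIndependent.of_comp (constOn E.classes).subtype
      (linearIndependent_sigma hE.chars_partition)
  have hcard : Fintype.card E.chars = Module.finrank ℂ (constOn E.classes) := by
    refine le_antisymm hli.fintype_card_le_finrank ?_
    rw [← Nat.card_eq_fintype_card]
    exact (finrank_constOn_le hE.classes_partition).trans hE.card_eq.ge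
  have hspan := hli.span_eq_top_of_card_eq_finrank' hcard
  have hmem : (⟨f, hf⟩ : constOn E.classes) ∈ Submodule.span ℂ (Set.range v) := by
    rw [hspan]; trivial
  obtain ⟨c, hc⟩ := (Submodule.mem_span_range_iff_exists_fun ℂ).1 hmem
  refine ⟨c, funext fun g => ?_⟩
  have := congrFun (congrArg Subtype.val hc) g
  simpa [v] using this.symm

/-- The ratio `[f, χ] / χ(1)`, for a superclass function `f`, depends only on the part of `χ`. -/
theorem charInner_mul_apply_one [Finite G] {E : PartPair G} (hE : E.IsSupercharacterTheory)
    {f : G → ℂ} (hf : f ∈ constOn E.classes) {X : Set (Irr G)}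
    (hX : X ∈ E.chars) {χ χ' : Irr G} (hχ : χ ∈ X) (hχ' : χ' ∈ X) :
    charInner f χ * χ' 1 = charInner f χ' * χ 1 := by
  classical
  have := Fintype.ofFinite E.chars
  obtain ⟨c, rfl⟩ := hE.exists_eq_sum_sigma hf
  have key : ∀ θ ∈ X, charInner (fun g => ∑ Y : E.chars, c Y * sigma (Y : Set (Irr G)) g) θ =
      c ⟨X, hX⟩ * θ 1 := fun θ hθ => by
    have h2 : ∀ Y : E.chars, θ ∈ (Y : Set (Irr G)) ↔ Y = ⟨X, hX⟩ := fun Y =>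
      ⟨fun h => Subtype.ext (eq_of_mem_of_mem hE.chars_partition Y.2 hX h hθ), fun h => h ▸ hθ⟩
    rw [charInner_sum_mul]
    simp only [charInner_sigma, h2, mul_ite, mul_zero, Finset.sum_ite_eq', Finset.mem_univ,
      if_true]
  rw [key χ hχ, key χ' hχ']
  ring

/-- Superclasses are closed under conjugation, as their indicator functions are combinations of the
class functions `σ_X`. -/
theorem conj_mem [Finite G] {E : PartPair G} (hE : E.IsSupercharacterTheory)
    {K : Set G} (hK : K ∈ E.classes) {g : G} (hg : g ∈ K) (h : G) :
    h * g * h⁻¹ ∈ K := by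
  classical
  have := Fintype.ofFinite E.chars
  have hf : K.indicator (fun _ => (1 : ℂ)) ∈ constOn E.classes := fun L hL a ha b hb => by
    have : a ∈ K ↔ b ∈ K :=
      ⟨fun h => by rwa [eq_of_mem_of_mem hE.classes_partition hK hL h ha],
        fun h => by rwa [eq_of_mem_of_mem hE.classes_partition hK hL h hb]⟩
    simp only [Set.indicator_apply, this]
  obtain ⟨c, hc⟩ := hE.exists_eq_sum_sigma hf
  have h1 : K.indicator (fun _ => (1 : ℂ)) (h * g * h⁻¹) = K.indicator (fun _ => (1 : ℂ)) g := by
    rw [hc]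
    simp only [sigma_apply_conj]
  rw [Set.indicator_of_mem hg] at h1
  by_contra hn
  rw [Set.indicator_of_notMem hn] at h1
  exact zero_ne_one h1

/-- The trivial character forms a part by itself: `1_G` is a superclass function orthogonal to all
other irreducible characters. -/
theorem trivialIrr_mem [Finite G] {E : PartPair G} (hE : E.IsSupercharacterTheory)
    : trivialIrr G ∈ E.chars := by
  classical
  obtain ⟨X, hX, hone⟩ := exists_mem_part hE.chars_partition (Irr.trivial G)
  have hf : (Irr.trivial G : Irr G).toFun ∈ constOn E.classes := fun _ _ _ _ _ _ => rfl
  have : X = trivialIrr G := by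
    rw [trivialIrr_eq_singleton]
    refine Set.eq_singleton_iff_unique_mem.2 ⟨hone, fun χ hχ => ?_⟩
    by_contra hne
    have h := hE.charInner_mul_apply_one hf hX hχ hone
    rw [charInner_irr, charInner_irr, if_pos rfl, if_neg (Ne.symm hne), zero_mul, one_mul] at h
    exact χ.apply_one_ne_zero h.symm
  exact this ▸ hX

theorem one_notMem {E : PartPair G} (hE : E.IsSupercharacterTheory)
    {K : Set G} (hK : K ∈ E.classes) (hne : K ≠ {1}) : (1 : G) ∉ K := fun h =>
  hne (eq_of_mem_of_mem hE.classes_partition hK hE.one_mem h rfl)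

theorem disjoint_trivialIrr [Finite G] {E : PartPair G} (hE : E.IsSupercharacterTheory)
    {X : Set (Irr G)} (hX : X ∈ E.chars) (hne : X ≠ trivialIrr G) :
    X ⊆ (trivialIrr G)ᶜ := fun _ h h' =>
  hne (eq_of_mem_of_mem hE.chars_partition hX hE.trivialIrr_mem h h')

end PartPair.IsSupercharacterTheory

end Superclass

/-! ### The star product -/

section StarProduct

variable {G : Type*} [Group G] {N : Subgroup G}

theorem induceSet_mono {X Y : Set (Irr N)} (h : X ⊆ Y) : induceSet N X ⊆ induceSet N Y :=
  Set.biUnion_subset_biUnion_left h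

theorem coe_image_subset (K : Set N) : ((↑) : N → G) '' K ⊆ (N : Set G) := by
  rintro _ ⟨n, -, rfl⟩
  exact n.2

theorem isNormalSubgroup_iff {E : PartPair G} (hE : Setoid.IsPartition E.classes) :
    E.IsNormalSubgroup N ↔ ∀ K ∈ E.classes, K ⊆ (N : Set G) ∨ Disjoint K (N : Set G) := by
  constructor
  · rintro ⟨S, hS, hN⟩ K hK
    by_cases h : K ∈ S
    · left
      rw [hN]
      exact Set.subset_sUnion_of_mem h
    · right
      rw [hN, Set.disjoint_sUnion_right]
      intro M hM
      refine Set.disjoint_left.2 fun x hxK hxM => h ?_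
      rwa [eq_of_mem_of_mem hE hK (hS hM) hxK hxM]
  · intro h
    refine ⟨{K ∈ E.classes | K ⊆ (N : Set G)}, fun K hK => hK.1, Set.Subset.antisymm ?_ ?_⟩
    · intro n hn
      obtain ⟨K, hK, hnK⟩ := exists_mem_part hE n
      exact ⟨K, ⟨hK, (h K hK).resolve_right fun hd => Set.disjoint_left.1 hd hnK hn⟩, hnK⟩
    · exact Set.sUnion_subset fun K hK => hK.2

theorem isUnionOfCosets_iff {K : Set G} :
    IsUnionOfCosets N K ↔ ∀ g ∈ K, ∀ h : G, (h : G ⧸ N) = g → h ∈ K := by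
  constructor
  · rintro ⟨T, rfl⟩ g hg h hgh
    rwa [Set.mem_preimage, hgh]
  · intro h
    refine ⟨((↑) : G → G ⧸ N) '' K, Set.Subset.antisymm (Set.subset_preimage_image _ _) ?_⟩
    rintro x ⟨g, hg, hgx⟩
    exact h g hg x hgx.symm

variable [N.Normal]

variable (N) in
/-- The pair on `N` read off from a pair on `G`: the sets of constituents of the character parts not
contained in `Irr(G/N)` together with `{1_N}`, and the superclasses inside `N`. -/
def PartPair.resPair (F : PartPair G) : PartPair N where
  chars := {X | ∃ Z ∈ F.chars, ¬ Z ⊆ irrQuotient N ∧ X = constituents N Z} ∪ {trivialIrr N}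
  classes := {K | ∃ M ∈ F.classes, M ⊆ (N : Set G) ∧ K = ((↑) : N → G) ⁻¹' M}

variable (N) in
/-- The pair on `G/N` read off from a pair on `G`: the character parts contained in `Irr(G/N)`, and
the images of the superclasses not inside `N` together with the identity class. -/
def PartPair.quotPair (F : PartPair G) : PartPair (G ⧸ N) where
  chars := {Y | ∃ Z ∈ F.chars, Z ⊆ irrQuotient N ∧ Y = deflateChars N Z}
  classes := {L | ∃ M ∈ F.classes, ¬ M ⊆ (N : Set G) ∧
    L = ((↑) : G → G ⧸ N) '' M} ∪ {{1}}

theorem PartPair.restrict_eq_resPair (E : PartPair G) :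
    E.restrict N = (E.join (minNormal N)).resPair N := rfl

theorem PartPair.quotient_eq_quotPair (E : PartPair G) :
    E.quotient N = (E.join (minNormal N)).quotPair N := rfl

theorem inflateChars_subset_irrQuotient (Y : Set (Irr (G ⧸ N))) :
    inflateChars N Y ⊆ irrQuotient N := by
  rw [inflateChars_eq_image]
  rintro _ ⟨ψ, -, rfl⟩
  exact inflate_mem_irrQuotient ψ

theorem deflateChars_inflateChars (Y : Set (Irr (G ⧸ N))) :
    deflateChars N (inflateChars N Y) = Y := by
  rw [deflateChars_eq_preimage, inflateChars_eq_image,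
    Set.preimage_image_eq _ inflate_injective]

theorem inflateChars_deflateChars [Finite G] {Z : Set (Irr G)} (hZ : Z ⊆ irrQuotient N) :
    inflateChars N (deflateChars N Z) = Z := by
  rw [deflateChars_eq_preimage, inflateChars_eq_image, Set.image_preimage_eq_iff, range_inflate]
  exact hZ

theorem disjoint_induceSet_irrQuotient [Finite G] {X : Set (Irr N)}
    (hX : X ⊆ (trivialIrr N)ᶜ) : Disjoint (induceSet N X) (irrQuotient N) := by
  refine Set.disjoint_left.2 fun χ hχ hq => ?_
  obtain ⟨ψ, hψ, hne⟩ := mem_induceSet_iff.1 hχ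
  exact hX hψ ((mem_irrQuotient_iff_of_resMult_ne_zero hne).1 hq)

theorem induceSet_nonempty [Finite G] {X : Set (Irr N)} (hX : X.Nonempty) :
    (induceSet N X).Nonempty := by
  obtain ⟨ψ, hψ⟩ := hX
  obtain ⟨χ, hχ⟩ := irrOver_nonempty (G := G) ψ
  exact ⟨χ, mem_induceSet_iff.2 ⟨ψ, hψ, hχ⟩⟩

theorem not_induceSet_subset_irrQuotient [Finite G] {X : Set (Irr N)} (hne : X.Nonempty)
    (hX : X ⊆ (trivialIrr N)ᶜ) : ¬ induceSet N X ⊆ irrQuotient N := fun h => by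
  obtain ⟨χ, hχ⟩ := induceSet_nonempty (G := G) hne
  exact Set.disjoint_left.1 (disjoint_induceSet_irrQuotient hX) hχ (h hχ)

theorem disjoint_mk_preimage {L : Set (G ⧸ N)} (hL : (1 : G ⧸ N) ∉ L) :
    Disjoint (((↑) : G → G ⧸ N) ⁻¹' L) (N : Set G) :=
  Set.disjoint_left.2 fun g hg hgN => hL (by
    rwa [Set.mem_preimage, (QuotientGroup.eq_one_iff g).2 hgN] at hg)

theorem not_mk_preimage_subset {L : Set (G ⧸ N)} (hne : L.Nonempty) (hL : (1 : G ⧸ N) ∉ L) :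
    ¬ ((↑) : G → G ⧸ N) ⁻¹' L ⊆ (N : Set G) := fun h => by
  obtain ⟨x, hx⟩ := hne
  obtain ⟨g, rfl⟩ := QuotientGroup.mk_surjective x
  exact Set.disjoint_left.1 (disjoint_mk_preimage hL) hx (h hx)

theorem conjNormal_mem {C : PartPair N} (hinv : C.IsInvariant) {K : Set N} (hK : K ∈ C.classes)
    {n : N} (hn : n ∈ K) (g : G) : MulAut.conjNormal g n ∈ K := by
  rw [← hinv K hK g]
  exact ⟨n, hn, rfl⟩

/-- If the superclasses are `G`-invariant, then so are the character parts. -/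
theorem isConjInvariant_of_mem_chars [Finite G] {C : PartPair N}
    (hC : C.IsSupercharacterTheory) (hinv : C.IsInvariant) {X : Set (Irr N)}
    (hX : X ∈ C.chars) : IsConjInvariant X := by
  classical
  intro ψ hψ g
  have hσ : ∀ (g : G) n, sigma X (MulAut.conjNormal g n) = sigma X n := fun g n => by
    obtain ⟨K, hK, hn⟩ := exists_mem_part hC.classes_partition n
    exact hC.sigma_const X hX K hK _ (conjNormal_mem hinv hK hn g) _ hn
  have h := charInner_conj hσ ψ g
  rw [charInner_sigma, charInner_sigma, if_pos hψ] at h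
  by_contra hn
  rw [if_neg hn] at h
  exact ψ.apply_one_ne_zero h.symm

section

variable [Finite G] {C : PartPair N} {D : PartPair (G ⧸ N)}

/-- The left factor is recovered from a star product: by Clifford's theorem, `constituents` inverts
`X ↦ X^G` on `G`-invariant sets. -/
theorem resPair_starProduct (hC : C.IsSupercharacterTheory) (hinv : C.IsInvariant)
    (hD : D.IsSupercharacterTheory) : (C.starProduct D).resPair N = C := by
  have hne : ∀ X ∈ C.chars, X ≠ trivialIrr N → ¬ induceSet N X ⊆ irrQuotient N := fun X hX h =>
    not_induceSet_subset_irrQuotient (Setoid.nonempty_of_mem_partition hC.chars_partition hX)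
      (hC.disjoint_trivialIrr hX h)
  refine PartPair.ext (Set.Subset.antisymm ?_ ?_) (Set.Subset.antisymm ?_ ?_)
  · rintro _ (⟨_, ⟨Y, hY, rfl⟩ | ⟨X, ⟨hX, -⟩, rfl⟩, hZ, rfl⟩ | rfl)
    · exact absurd (inflateChars_subset_irrQuotient Y) hZ
    · rwa [constituents_induceSet (isConjInvariant_of_mem_chars hC hinv hX)]
    · exact hC.trivialIrr_mem
  · intro X hX
    by_cases h : X = trivialIrr N
    · exact Or.inr h
    · exact Or.inl ⟨_, Or.inr ⟨X, ⟨hX, h⟩, rfl⟩, hne X hX h,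
        (constituents_induceSet (isConjInvariant_of_mem_chars hC hinv hX)).symm⟩
  · rintro _ ⟨_, ⟨K, hK, rfl⟩ | ⟨L, ⟨hL, hL1⟩, rfl⟩, hM, rfl⟩
    · rwa [Set.preimage_image_eq _ Subtype.val_injective]
    · exact absurd hM (not_mk_preimage_subset
        (Setoid.nonempty_of_mem_partition hD.classes_partition hL) (hD.one_notMem hL hL1))
  · intro K hK
    exact ⟨_, Or.inl ⟨K, hK, rfl⟩, coe_image_subset K,
      (Set.preimage_image_eq _ Subtype.val_injective).symm⟩

theorem quotPair_starProduct (hC : C.IsSupercharacterTheory)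
    (hD : D.IsSupercharacterTheory) : (C.starProduct D).quotPair N = D := by
  have hne : ∀ X ∈ C.chars, X ≠ trivialIrr N → ¬ induceSet N X ⊆ irrQuotient N := fun X hX h =>
    not_induceSet_subset_irrQuotient (Setoid.nonempty_of_mem_partition hC.chars_partition hX)
      (hC.disjoint_trivialIrr hX h)
  refine PartPair.ext (Set.Subset.antisymm ?_ ?_) (Set.Subset.antisymm ?_ ?_)
  · rintro _ ⟨_, ⟨Y, hY, rfl⟩ | ⟨X, ⟨hX, hX1⟩, rfl⟩, hZ, rfl⟩
    · rwa [deflateChars_inflateChars]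
    · exact absurd hZ (hne X hX hX1)
  · intro Y hY
    exact ⟨_, Or.inl ⟨Y, hY, rfl⟩, inflateChars_subset_irrQuotient Y,
      (deflateChars_inflateChars Y).symm⟩
  · rintro _ (⟨_, ⟨K, hK, rfl⟩ | ⟨L, ⟨hL, -⟩, rfl⟩, hM, rfl⟩ | rfl)
    · exact absurd (coe_image_subset K) hM
    · rwa [Set.image_preimage_eq _ QuotientGroup.mk_surjective]
    · exact hD.one_mem
  · intro L hL
    by_cases h : L = {1}
    · exact Or.inr h
    · exact Or.inl ⟨_, Or.inr ⟨L, ⟨hL, h⟩, rfl⟩, not_mk_preimage_subset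
        (Setoid.nonempty_of_mem_partition hD.classes_partition hL) (hD.one_notMem hL h),
        (Set.image_preimage_eq _ QuotientGroup.mk_surjective).symm⟩

theorem minNormal_le_starProduct (hC : C.IsSupercharacterTheory) (hinv : C.IsInvariant)
    (hD : D.IsSupercharacterTheory) : minNormal N ≤ C.starProduct D := by
  refine ⟨?_, ?_⟩
  · rintro _ (⟨_, ⟨χ, rfl⟩, rfl⟩ | ⟨_, ⟨⟨ψ, rfl⟩, hne⟩, rfl⟩)
    · obtain ⟨Y, hY, hχ⟩ := exists_mem_part hD.chars_partition χ
      refine ⟨_, Or.inl ⟨Y, hY, rfl⟩, ?_⟩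
      rw [inflateChars_eq_image, inflateChars_eq_image]
      exact Set.image_mono (Set.singleton_subset_iff.2 hχ)
    · obtain ⟨X, hX, hψ⟩ := exists_mem_part hC.chars_partition ψ
      have hsub : {θ : Irr N | ∃ g : G, ∀ h, θ h = ψ (MulAut.conjNormal g h)} ⊆ X := by
        rintro θ ⟨g, hθ⟩
        rw [show θ = Irr.conj g ψ from Irr.ext hθ]
        exact isConjInvariant_of_mem_chars hC hinv hX ψ hψ g
      refine ⟨_, Or.inr ⟨X, ⟨hX, fun h => hne ?_⟩, rfl⟩, induceSet_mono hsub⟩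
      have h : X = trivialIrr N := h
      rw [h] at hsub
      refine Set.mem_singleton_iff.2 (Set.Subset.antisymm hsub fun θ hθ => ⟨1, fun n => ?_⟩)
      have hψ1 := hsub (show ψ ∈ {θ : Irr N | ∃ g : G, ∀ h, θ h = ψ (MulAut.conjNormal g h)} from
        ⟨1, fun n => by simp⟩)
      rw [hθ, hψ1]
  · rintro _ (⟨_, ⟨n, rfl⟩, rfl⟩ | ⟨_, ⟨⟨x, rfl⟩, hne⟩, rfl⟩)
    · obtain ⟨K, hK, hn⟩ := exists_mem_part hC.classes_partition n
      refine ⟨_, Or.inl ⟨K, hK, rfl⟩, Set.image_mono ?_⟩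
      rintro _ ⟨g, y, rfl⟩
      exact conjNormal_mem hinv hK (hC.conj_mem hK hn y) g
    · obtain ⟨L, hL, hx⟩ := exists_mem_part hD.classes_partition x
      have hsub : conjugatesOf x ⊆ L := by
        intro y hy
        obtain ⟨c, rfl⟩ := isConj_iff.1 hy
        exact hD.conj_mem hL hx c
      refine ⟨_, Or.inr ⟨L, ⟨hL, fun h => hne ?_⟩, rfl⟩, Set.preimage_mono hsub⟩
      have h : L = {1} := h
      rw [h] at hsub
      exact Set.mem_singleton_iff.2 (Set.Subset.antisymm hsub fun y hy => by
        rw [Set.mem_singleton_iff.1 hy, ← Set.mem_singleton_iff.1 (hsub (mem_conjugatesOf_self))]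
        exact mem_conjugatesOf_self)

theorem le_maxTheory {H : Type*} [Group H] [Finite H] {F : PartPair H}
    (hF : F.IsSupercharacterTheory) : F ≤ maxTheory H := by
  constructor
  · intro X hX
    by_cases h : X = trivialIrr H
    · exact ⟨X, ⟨Or.inl h, Setoid.nonempty_of_mem_partition hF.chars_partition hX⟩, subset_rfl⟩
    · have hsub := hF.disjoint_trivialIrr hX h
      exact ⟨_, ⟨Or.inr rfl,
        (Setoid.nonempty_of_mem_partition hF.chars_partition hX).mono hsub⟩, hsub⟩
  · intro K hK
    by_cases h : K = {1}
    · exact ⟨K, ⟨Or.inl h, Setoid.nonempty_of_mem_partition hF.classes_partition hK⟩, subset_rfl⟩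
    · have hsub : K ⊆ {1}ᶜ := fun x hx hx1 => hF.one_notMem hK h (Set.mem_singleton_iff.1 hx1 ▸ hx)
      exact ⟨_, ⟨Or.inr rfl,
        (Setoid.nonempty_of_mem_partition hF.classes_partition hK).mono hsub⟩, hsub⟩

theorem starProduct_le_maxNormal (hC : C.IsSupercharacterTheory)
    (hD : D.IsSupercharacterTheory) : C.starProduct D ≤ maxNormal N := by
  constructor
  · rintro _ (⟨Y, hY, rfl⟩ | ⟨X, ⟨hX, hne⟩, rfl⟩)
    · obtain ⟨Y', hY', hsub⟩ := (le_maxTheory hD).1 Y hY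
      refine ⟨_, Or.inl ⟨Y', hY', rfl⟩, ?_⟩
      rw [inflateChars_eq_image, inflateChars_eq_image]
      exact Set.image_mono hsub
    · have hsub := hC.disjoint_trivialIrr hX hne
      have hXne := Setoid.nonempty_of_mem_partition hC.chars_partition hX
      refine ⟨_, Or.inr ⟨(trivialIrr N)ᶜ, ⟨⟨Or.inr rfl, hXne.mono hsub⟩, fun h => ?_⟩, rfl⟩,
        induceSet_mono hsub⟩
      have h : (trivialIrr N)ᶜ = trivialIrr N := h
      obtain ⟨ψ, hψ⟩ := hXne
      exact hsub hψ (h ▸ hsub hψ)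
  · rintro _ (⟨K, hK, rfl⟩ | ⟨L, ⟨hL, hne⟩, rfl⟩)
    · obtain ⟨K', hK', hsub⟩ := (le_maxTheory hC).2 K hK
      exact ⟨_, Or.inl ⟨K', hK', rfl⟩, Set.image_mono hsub⟩
    · have hsub : L ⊆ {1}ᶜ := fun x hx hx1 =>
        hD.one_notMem hL hne (Set.mem_singleton_iff.1 hx1 ▸ hx)
      have hLne := Setoid.nonempty_of_mem_partition hD.classes_partition hL
      refine ⟨_, Or.inr ⟨{1}ᶜ, ⟨⟨Or.inr rfl, hLne.mono hsub⟩, fun h => ?_⟩, rfl⟩,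
        Set.preimage_mono hsub⟩
      have h : ({1}ᶜ : Set (G ⧸ N)) = {1} := h
      obtain ⟨x, hx⟩ := hLne
      exact hsub hx (h ▸ hsub hx)

end

/-- `m(N ◁ G) ≤ E ≤ M(N ◁ G)` already forces the condition on superclasses. -/
theorem isNormalSubgroup_and_isUnionOfCosets_of_le {E : PartPair G}
    (hE : Setoid.IsPartition E.classes) (hmin : minNormal N ≤ E) (hmax : E ≤ maxNormal N) :
    E.IsNormalSubgroup N ∧ ∀ K ∈ E.classes, Disjoint K (N : Set G) → IsUnionOfCosets N K := by
  constructor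
  · rw [isNormalSubgroup_iff hE]
    intro K hK
    obtain ⟨_, ⟨K', -, rfl⟩ | ⟨L, ⟨⟨hL, -⟩, hne⟩, rfl⟩, hsub⟩ := hmax.2 K hK
    · exact Or.inl (hsub.trans (coe_image_subset K'))
    · right
      refine (disjoint_mk_preimage ?_).mono_left hsub
      rw [hL.resolve_left hne]
      exact fun h => h rfl
  · intro K hK hd
    rw [isUnionOfCosets_iff]
    intro g hg h hgh
    have hne : conjugatesOf (g : G ⧸ N) ≠ {1} := fun h1 => by
      have : (g : G ⧸ N) ∈ ({1} : Set (G ⧸ N)) := h1 ▸ mem_conjugatesOf_self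
      exact Set.disjoint_left.1 hd hg ((QuotientGroup.eq_one_iff g).1 this)
    obtain ⟨K', hK', hsub⟩ := hmin.2 _ (Or.inr ⟨_, ⟨⟨(g : G ⧸ N), rfl⟩, hne⟩, rfl⟩)
    have hgK' : g ∈ K' := hsub (show (g : G ⧸ N) ∈ conjugatesOf (g : G ⧸ N) from
      mem_conjugatesOf_self)
    have hhK' : h ∈ K' := hsub (show (h : G ⧸ N) ∈ conjugatesOf (g : G ⧸ N) by
      rw [hgh]; exact mem_conjugatesOf_self)
    rwa [eq_of_mem_of_mem hE hK hK' hg hgK']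

end StarProduct

/-! ### Existence of the factorization -/

section Factorization

variable {G : Type*} [Group G] {N : Subgroup G}

/-- `N` is a union of superclasses of `E`, and each superclass outside `N` is a union of
cosets of `N`. -/
structure PartPair.IsCompatible (E : PartPair G) (N : Subgroup G) : Prop where
  subset_or_disjoint : ∀ K ∈ E.classes, K ⊆ (N : Set G) ∨ Disjoint K (N : Set G)
  mem_of_mk_eq : ∀ K ∈ E.classes, Disjoint K (N : Set G) →
    ∀ g ∈ K, ∀ h : G, (h : G ⧸ N) = g → h ∈ K

theorem PartPair.IsCompatible.mk_preimage_image {E : PartPair G} (hN : E.IsCompatible N) {K : Set G}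
    (hK : K ∈ E.classes) (hs : ¬ K ⊆ (N : Set G)) :
    ((↑) : G → G ⧸ N) ⁻¹' (((↑) : G → G ⧸ N) '' K) = K := by
  refine Set.Subset.antisymm ?_ (Set.subset_preimage_image _ _)
  rintro h ⟨g, hg, hgh⟩
  exact hN.mem_of_mk_eq K hK ((hN.subset_or_disjoint K hK).resolve_left hs) g hg h hgh.symm

theorem isPartition_resPair_classes {E : PartPair G}
    (hE : Setoid.IsPartition E.classes) (hN : E.IsCompatible N) :
    Setoid.IsPartition (E.resPair N).classes := by
  refine isPartition_of_forall ?_ (fun n => ?_) ?_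
  · rintro _ ⟨M, hM, hs, rfl⟩
    obtain ⟨g, hg⟩ := Setoid.nonempty_of_mem_partition hE hM
    exact ⟨⟨g, hs hg⟩, hg⟩
  · obtain ⟨M, hM, hn⟩ := exists_mem_part hE (n : G)
    exact ⟨_, ⟨M, hM, (hN.subset_or_disjoint M hM).resolve_right fun hd =>
      Set.disjoint_left.1 hd hn n.2, rfl⟩, hn⟩
  · rintro _ ⟨M, hM, -, rfl⟩ _ ⟨M', hM', -, rfl⟩ n hn hn'
    rw [eq_of_mem_of_mem hE hM hM' hn hn']

variable [N.Normal]

theorem isPartition_quotPair_classes {E : PartPair G}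
    (hE : Setoid.IsPartition E.classes) (hN : E.IsCompatible N) :
    Setoid.IsPartition (E.quotPair N).classes := by
  have hone : ∀ M ∈ E.classes, ¬ M ⊆ (N : Set G) → (1 : G ⧸ N) ∉ ((↑) : G → G ⧸ N) '' M := by
    rintro M hM hs ⟨g, hg, hg1⟩
    exact Set.disjoint_left.1 ((hN.subset_or_disjoint M hM).resolve_left hs) hg
      ((QuotientGroup.eq_one_iff g).1 hg1)
  refine isPartition_of_forall ?_ (fun x => ?_) ?_
  · rintro _ (⟨M, hM, -, rfl⟩ | rfl)
    · exact (Setoid.nonempty_of_mem_partition hE hM).image _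
    · exact Set.singleton_nonempty 1
  · obtain ⟨g, rfl⟩ := QuotientGroup.mk_surjective x
    obtain ⟨M, hM, hg⟩ := exists_mem_part hE g
    rcases hN.subset_or_disjoint M hM with hs | hd
    · exact ⟨_, Or.inr rfl, (QuotientGroup.eq_one_iff g).2 (hs hg)⟩
    · exact ⟨_, Or.inl ⟨M, hM, fun hs => Set.disjoint_left.1 hd hg (hs hg), rfl⟩, g, hg, rfl⟩
  · rintro _ (⟨M, hM, hs, rfl⟩ | rfl) _ (⟨M', hM', hs', rfl⟩ | rfl) x hx hx'
    · obtain ⟨g, rfl⟩ := QuotientGroup.mk_surjective x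
      rw [← Set.mem_preimage, hN.mk_preimage_image hM hs] at hx
      rw [← Set.mem_preimage, hN.mk_preimage_image hM' hs'] at hx'
      rw [eq_of_mem_of_mem hE hM hM' hx hx']
    · exact absurd (Set.mem_singleton_iff.1 hx' ▸ hx) (hone M hM hs)
    · exact absurd (Set.mem_singleton_iff.1 hx ▸ hx') (hone M' hM' hs')
    · rfl

variable [Finite G]

theorem ncard_chars_starProduct {C : PartPair N} {D : PartPair (G ⧸ N)}
    (hC : Setoid.IsPartition C.chars) (hinv : ∀ X ∈ C.chars, IsConjInvariant X)
    (htriv : trivialIrr N ∈ C.chars) :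
    (C.starProduct D).chars.ncard + 1 = D.chars.ncard + C.chars.ncard := by
  have hsub : ∀ X ∈ C.chars \ {trivialIrr N}, X ⊆ (trivialIrr N)ᶜ := fun X hX ψ hψ hψ1 =>
    hX.2 (eq_of_mem_of_mem hC hX.1 htriv hψ hψ1)
  have hdisj : Disjoint (inflateChars N '' D.chars)
      (induceSet N '' (C.chars \ {trivialIrr N})) := by
    refine Set.disjoint_left.2 ?_
    rintro _ ⟨Y, -, rfl⟩ ⟨X, hX, h⟩
    exact not_induceSet_subset_irrQuotient (Setoid.nonempty_of_mem_partition hC hX.1) (hsub X hX)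
      (h ▸ inflateChars_subset_irrQuotient Y)
  have hinj : Set.InjOn (induceSet N) (C.chars \ {trivialIrr N}) := fun X hX Y hY h => by
    rw [← constituents_induceSet (hinv X hX.1), h, constituents_induceSet (hinv Y hY.1)]
  rw [PartPair.starProduct, Set.ncard_union_eq hdisj (Set.toFinite _) (Set.toFinite _),
    Set.ncard_image_of_injective _ (Function.LeftInverse.injective deflateChars_inflateChars),
    hinj.ncard_image, add_assoc,
    Set.ncard_sdiff_singleton_add_one htriv (Set.toFinite _)]

theorem ncard_classes_starProduct {C : PartPair N} {D : PartPair (G ⧸ N)}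
    (hD : Setoid.IsPartition D.classes) (hone : {1} ∈ D.classes) :
    (C.starProduct D).classes.ncard + 1 = C.classes.ncard + D.classes.ncard := by
  have hdisj : Disjoint ((fun K : Set N => ((↑) : N → G) '' K) '' C.classes)
      ((fun L : Set (G ⧸ N) => ((↑) : G → G ⧸ N) ⁻¹' L) '' (D.classes \ {{1}})) := by
    refine Set.disjoint_left.2 ?_
    rintro _ ⟨K, -, rfl⟩ ⟨L, hL, h⟩
    refine not_mk_preimage_subset (Setoid.nonempty_of_mem_partition hD hL.1) (fun h1 => ?_)
      (h.trans_subset (coe_image_subset K))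
    exact hL.2 (eq_of_mem_of_mem hD hL.1 hone h1 rfl)
  rw [PartPair.starProduct, Set.ncard_union_eq hdisj (Set.toFinite _) (Set.toFinite _),
    Set.ncard_image_of_injective _ Subtype.val_injective.image_injective,
    Set.ncard_image_of_injective _ QuotientGroup.mk_surjective.preimage_injective, add_assoc,
    Set.ncard_sdiff_singleton_add_one hone (Set.toFinite _)]

theorem sum_apply_mul_eq_zero [Fintype N] {χ : Irr G} (hχ : χ ∉ irrQuotient N) (g : G) :
    ∑ n : N, χ (n * g) = 0 := by
  have := Fintype.ofFinite G
  have hcN : (Nat.card N : ℂ) ≠ 0 := Nat.cast_ne_zero.2 Nat.card_pos.ne'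
  have h := χ.sum_mul_apply_mul
    (fun x h => extend_conjNormal (N := N) (f := fun _ => (1 : ℂ)) (fun _ _ => rfl) x h) g
  rw [sum_extend_mul (fun _ : N => (1 : ℂ)) fun x => χ (x * g),
    sum_extend_mul (fun _ : N => (1 : ℂ)) χ] at h
  have h0 : ∑ n : N, 1 * χ (n : G) = 0 := by
    rw [mem_irrQuotient_iff_resMult_trivial, not_not, resMult, charInner_eq_sum, mul_eq_zero,
      or_iff_right (inv_ne_zero hcN)] at hχ
    simpa using hχ
  rw [h0, zero_mul, mul_eq_zero, or_iff_left χ.apply_one_ne_zero] at h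
  simpa using h

namespace PartPair.IsSupercharacterTheory

variable {E : PartPair G}

/-- The indicator function of `N` is a superclass function, and its inner product with an
irreducible character is nonzero exactly on `Irr(G/N)`; so `Irr(G/N)` is a union of parts. -/
theorem chars_subset_or_disjoint (hE : E.IsSupercharacterTheory) (hN : E.IsCompatible N)
    {X : Set (Irr G)} (hX : X ∈ E.chars) :
    X ⊆ irrQuotient N ∨ Disjoint X (irrQuotient N) := by
  have hcN : (Nat.card N : ℂ) ≠ 0 := Nat.cast_ne_zero.2 Nat.card_pos.ne'
  have hcG : (Nat.card G : ℂ) ≠ 0 := Nat.cast_ne_zero.2 Nat.card_pos.ne'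
  have hf : Function.extend ((↑) : N → G) (fun _ => (1 : ℂ)) 0 ∈ constOn E.classes := by
    intro K hK g hg h hh
    rcases hN.subset_or_disjoint K hK with hs | hd
    · exact (Subtype.val_injective.extend_apply (fun _ : N => (1 : ℂ)) 0 ⟨g, hs hg⟩).trans
        (Subtype.val_injective.extend_apply (fun _ : N => (1 : ℂ)) 0 ⟨h, hs hh⟩).symm
    · rw [Function.extend_apply' _ _ g fun ⟨n, hn⟩ => Set.disjoint_left.1 hd hg (hn ▸ n.2),
        Function.extend_apply' _ _ h fun ⟨n, hn⟩ => Set.disjoint_left.1 hd hh (hn ▸ n.2)]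
      rfl
  by_contra! hcon
  obtain ⟨h1, h2⟩ := hcon
  obtain ⟨χ, hχ, hχq⟩ := Set.not_subset.1 h1
  obtain ⟨χ', hχ', hχq'⟩ := Set.not_disjoint_iff.1 h2
  have h := hE.charInner_mul_apply_one hf hX hχ hχ'
  rw [charInner_extend_one, charInner_extend_one] at h
  rw [mem_irrQuotient_iff_resMult_trivial, not_not] at hχq
  rw [mem_irrQuotient_iff_resMult_trivial] at hχq'
  rw [hχq, mul_zero, zero_mul, eq_comm] at h
  exact mul_ne_zero (mul_ne_zero (div_ne_zero hcN hcG) hχq') χ.apply_one_ne_zero h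

/-- The functions `σ_X` with `X` outside `Irr(G/N)` sum to zero over each coset of `N`, and are
constant on the cosets other than `N` itself. -/
theorem sigma_eq_zero_of_notMem (hE : E.IsSupercharacterTheory) (hN : E.IsCompatible N)
    {X : Set (Irr G)} (hX : X ∈ E.chars) (hd : Disjoint X (irrQuotient N)) {g : G} (hg : g ∉ N) :
    sigma X g = 0 := by
  classical
  have := Fintype.ofFinite N
  have := Fintype.ofFinite (Irr G)
  have hcN : (Nat.card N : ℂ) ≠ 0 := Nat.cast_ne_zero.2 Nat.card_pos.ne'
  obtain ⟨K, hK, hgK⟩ := exists_mem_part hE.classes_partition g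
  have hKd := (hN.subset_or_disjoint K hK).resolve_left fun h => hg (h hgK)
  have h1 : ∀ n : N, sigma X (n * g) = sigma X g := fun n =>
    hE.sigma_const X hX K hK _ (hN.mem_of_mk_eq K hK hKd g hgK _ (by
      rw [QuotientGroup.mk_mul, (QuotientGroup.eq_one_iff (n : G)).2 n.2, one_mul])) _ hgK
  have h2 : ∑ n : N, sigma X (n * g) = 0 := by
    simp only [sigma_eq_sum]
    rw [Finset.sum_comm]
    refine Finset.sum_eq_zero fun χ _ => ?_
    rw [← Finset.mul_sum]
    split_ifs with hχ
    · rw [sum_apply_mul_eq_zero (Set.disjoint_left.1 hd hχ), mul_zero]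
    · rw [zero_mul]
  simp only [h1, Finset.sum_const, Finset.card_univ, nsmul_eq_mul,
    ← Nat.card_eq_fintype_card] at h2
  exact (mul_eq_zero.1 h2).resolve_left hcN

/-- A part outside `Irr(G/N)` contains `Irr(G|ψ)` as soon as it meets it: whether `χ` lies in `X` is
decided by the inner product of `χ_N` with `σ_X`, and the restrictions of the members of `Irr(G|ψ)`
are proportional. -/
theorem mem_of_resMult_ne_zero (hE : E.IsSupercharacterTheory) (hN : E.IsCompatible N)
    {X : Set (Irr G)} (hX : X ∈ E.chars) (hd : Disjoint X (irrQuotient N)) {χ χ' : Irr G}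
    {ψ : Irr N} (hχ : χ ∈ X) (h : resMult N χ ψ ≠ 0) (h' : resMult N χ' ψ ≠ 0) : χ' ∈ X := by
  classical
  have := Fintype.ofFinite N
  have hext : sigma X = Function.extend ((↑) : N → G) (fun n : N => sigma X n) 0 := by
    funext g
    by_cases hg : g ∈ N
    · exact (Subtype.val_injective.extend_apply (fun n : N => sigma X n) 0 ⟨g, hg⟩).symm
    · rw [hE.sigma_eq_zero_of_notMem hN hX hd hg,
        Function.extend_apply' _ _ g fun ⟨n, hn⟩ => hg (hn ▸ n.2)]
      rfl
  have h1 := charInner_sigma X χ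
  have h2 := charInner_sigma X χ'
  rw [hext, charInner_extend, if_pos hχ] at h1
  rw [hext, charInner_extend] at h2
  by_contra hn
  rw [if_neg hn] at h2
  have key : resMult N χ' ψ * ∑ n : N, sigma X n * χ ((n⁻¹ : N) : G) =
      resMult N χ ψ * ∑ n : N, sigma X n * χ' ((n⁻¹ : N) : G) := by
    rw [Finset.mul_sum, Finset.mul_sum]
    refine Finset.sum_congr rfl fun n _ => ?_
    rw [mul_left_comm, resMult_mul_apply_eq h h', mul_left_comm]
  have hzero : resMult N χ' ψ * χ 1 = 0 := by
    rw [← h1, mul_left_comm, key, mul_left_comm, h2, mul_zero]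
  exact mul_ne_zero h' χ.apply_one_ne_zero hzero

end PartPair.IsSupercharacterTheory

theorem isConjInvariant_constituents (Z : Set (Irr G)) : IsConjInvariant (constituents N Z) := by
  rintro ψ ⟨χ, hχ, h⟩ g
  refine ⟨χ, hχ, ?_⟩
  rw [mem_irrOver_iff, resMult_conj]
  exact h

namespace PartPair.IsSupercharacterTheory

variable {E : PartPair G}

theorem induceSet_constituents (hE : E.IsSupercharacterTheory) (hN : E.IsCompatible N)
    {X : Set (Irr G)} (hX : X ∈ E.chars) (hd : Disjoint X (irrQuotient N)) :
    induceSet N (constituents N X) = X := by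
  ext χ
  rw [mem_induceSet_iff]
  constructor
  · rintro ⟨ψ, ⟨χ', hχ', h'⟩, h⟩
    exact hE.mem_of_resMult_ne_zero hN hX hd hχ' h' h
  · intro hχ
    obtain ⟨ψ, hψ⟩ := exists_resMult_ne_zero (N := N) χ
    exact ⟨ψ, ⟨χ, hχ, hψ⟩, hψ⟩

theorem disjoint_of_not_subset (hE : E.IsSupercharacterTheory) (hN : E.IsCompatible N)
    {X : Set (Irr G)} (hX : X ∈ E.chars) (hs : ¬ X ⊆ irrQuotient N) :
    Disjoint X (irrQuotient N) :=
  (hE.chars_subset_or_disjoint hN hX).resolve_left hs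

theorem isPartition_resPair_chars (hE : E.IsSupercharacterTheory) (hN : E.IsCompatible N) :
    Setoid.IsPartition (E.resPair N).chars := by
  have hdisj : ∀ X ∈ E.chars, ¬ X ⊆ irrQuotient N → ∀ ψ ∈ constituents N X, ψ ∉ trivialIrr N := by
    rintro X hX hs ψ ⟨χ, hχ, h⟩ hψ
    exact Set.disjoint_left.1 (hE.disjoint_of_not_subset hN hX hs) hχ
      ((mem_irrQuotient_iff_of_resMult_ne_zero h).2 hψ)
  refine isPartition_of_forall ?_ (fun ψ => ?_) ?_
  · rintro _ (⟨X, hX, -, rfl⟩ | rfl)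
    · obtain ⟨χ, hχ⟩ := Setoid.nonempty_of_mem_partition hE.chars_partition hX
      obtain ⟨ψ, hψ⟩ := exists_resMult_ne_zero (N := N) χ
      exact ⟨ψ, χ, hχ, hψ⟩
    · exact ⟨_, trivial_mem_trivialIrr⟩
  · by_cases hψ : ψ ∈ trivialIrr N
    · exact ⟨_, Or.inr rfl, hψ⟩
    · obtain ⟨χ, hχ⟩ := irrOver_nonempty (G := G) ψ
      obtain ⟨X, hX, hχX⟩ := exists_mem_part hE.chars_partition χ
      exact ⟨_, Or.inl ⟨X, hX, fun hs =>
        hψ ((mem_irrQuotient_iff_of_resMult_ne_zero hχ).1 (hs hχX)), rfl⟩, χ, hχX, hχ⟩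
  · rintro _ (⟨X, hX, hs, rfl⟩ | rfl) _ (⟨Y, hY, hs', rfl⟩ | rfl) ψ hψ hψ'
    · obtain ⟨χ, hχ, h⟩ := hψ
      obtain ⟨χ', hχ', h'⟩ := hψ'
      rw [eq_of_mem_of_mem hE.chars_partition hX hY (hE.mem_of_resMult_ne_zero hN hX
        (hE.disjoint_of_not_subset hN hX hs) hχ h h') hχ']
    · exact absurd hψ' (hdisj X hX hs ψ hψ)
    · exact absurd hψ (hdisj Y hY hs' ψ hψ')
    · rfl

theorem sigma_mem_constOn_resPair (hE : E.IsSupercharacterTheory) (hN : E.IsCompatible N) :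
    ∀ X ∈ (E.resPair N).chars, sigma X ∈ constOn (E.resPair N).classes := by
  have hcN : (Nat.card N : ℂ) ≠ 0 := Nat.cast_ne_zero.2 Nat.card_pos.ne'
  have hcG : (Nat.card G : ℂ) ≠ 0 := Nat.cast_ne_zero.2 Nat.card_pos.ne'
  rintro _ (⟨X, hX, hs, rfl⟩ | rfl) _ ⟨M, hM, -, rfl⟩ g hg h hh
  · have key : ∀ n : N, sigma X n = Nat.card G / Nat.card N * sigma (constituents N X) n :=
      fun n => by
        conv_lhs => rw [← hE.induceSet_constituents hN hX (hE.disjoint_of_not_subset hN hX hs)]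
        rw [sigma_induceSet (isConjInvariant_constituents X), Subtype.val_injective.extend_apply]
    have h1 := hE.sigma_const X hX M hM _ hg _ hh
    rw [key, key] at h1
    exact mul_left_cancel₀ (div_ne_zero hcG hcN) h1
  · have : ∀ n : N, sigma (trivialIrr N) n = 1 := fun n => by
      rw [trivialIrr_eq_singleton, sigma, finsum_mem_singleton, Irr.trivial_apply,
        Irr.trivial_apply, mul_one]
    rw [this, this]

theorem isPartition_quotPair_chars (hE : E.IsSupercharacterTheory) (hN : E.IsCompatible N) :
    Setoid.IsPartition (E.quotPair N).chars := by
  refine isPartition_of_forall ?_ (fun ψ => ?_) ?_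
  · rintro _ ⟨Z, hZ, hs, rfl⟩
    have h := Setoid.nonempty_of_mem_partition hE.chars_partition hZ
    rw [← inflateChars_deflateChars hs, inflateChars_eq_image] at h
    exact h.of_image
  · obtain ⟨Z, hZ, hψ⟩ := exists_mem_part hE.chars_partition ψ.inflate
    refine ⟨_, ⟨Z, hZ, ?_, rfl⟩, by rwa [deflateChars_eq_preimage]⟩
    exact (hE.chars_subset_or_disjoint hN hZ).resolve_right fun hd =>
      Set.disjoint_left.1 hd hψ (inflate_mem_irrQuotient ψ)
  · rintro _ ⟨Z, hZ, -, rfl⟩ _ ⟨Z', hZ', -, rfl⟩ ψ hψ hψ'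
    rw [deflateChars_eq_preimage] at hψ hψ'
    rw [eq_of_mem_of_mem hE.chars_partition hZ hZ' hψ hψ']

theorem sigma_mem_constOn_quotPair (hE : E.IsSupercharacterTheory) :
    ∀ Y ∈ (E.quotPair N).chars, sigma Y ∈ constOn (E.quotPair N).classes := by
  rintro _ ⟨Z, hZ, hs, rfl⟩ _ (⟨M, hM, -, rfl⟩ | rfl) x hx y hy
  · obtain ⟨g, hg, rfl⟩ := hx
    obtain ⟨h, hh, rfl⟩ := hy
    rw [← sigma_inflate, ← sigma_inflate, ← inflateChars_eq_image, inflateChars_deflateChars hs]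
    exact hE.sigma_const Z hZ M hM g hg h hh
  · rw [Set.mem_singleton_iff.1 hx, Set.mem_singleton_iff.1 hy]

theorem eq_starProduct_of_isCompatible (hE : E.IsSupercharacterTheory) (hN : E.IsCompatible N) :
    E = (E.resPair N).starProduct (E.quotPair N) := by
  refine PartPair.ext (Set.Subset.antisymm ?_ ?_) (Set.Subset.antisymm ?_ ?_)
  · intro X hX
    by_cases hs : X ⊆ irrQuotient N
    · exact Or.inl ⟨_, ⟨X, hX, hs, rfl⟩, inflateChars_deflateChars hs⟩
    · have hd := hE.disjoint_of_not_subset hN hX hs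
      have hind := hE.induceSet_constituents hN hX hd
      refine Or.inr ⟨_, ⟨Or.inl ⟨X, hX, hs, rfl⟩, fun h => ?_⟩, hind⟩
      have h : constituents N X = trivialIrr N := h
      obtain ⟨χ, hχ⟩ := Setoid.nonempty_of_mem_partition hE.chars_partition hX
      obtain ⟨ψ, hψ⟩ := exists_resMult_ne_zero (N := N) χ
      have hψ1 : ψ ∈ trivialIrr N := h ▸ ⟨χ, hχ, hψ⟩
      exact Set.disjoint_left.1 hd hχ ((mem_irrQuotient_iff_of_resMult_ne_zero hψ).2 hψ1)
  · rintro _ (⟨_, ⟨Z, hZ, hs, rfl⟩, rfl⟩ | ⟨_, ⟨⟨Z, hZ, hs, rfl⟩ | h, hne⟩, rfl⟩)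
    · rwa [inflateChars_deflateChars hs]
    · rwa [hE.induceSet_constituents hN hZ (hE.disjoint_of_not_subset hN hZ hs)]
    · exact absurd h hne
  · intro K hK
    rcases hN.subset_or_disjoint K hK with hs | hd
    · refine Or.inl ⟨_, ⟨K, hK, hs, rfl⟩, ?_⟩
      exact Set.image_preimage_eq_of_subset (by rwa [Subtype.range_coe])
    · have hs : ¬ K ⊆ (N : Set G) := fun hs => by
        obtain ⟨g, hg⟩ := Setoid.nonempty_of_mem_partition hE.classes_partition hK
        exact Set.disjoint_left.1 hd hg (hs hg)
      refine Or.inr ⟨_, ⟨Or.inl ⟨K, hK, hs, rfl⟩, fun h => ?_⟩, hN.mk_preimage_image hK hs⟩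
      have h : ((↑) : G → G ⧸ N) '' K = {1} := h
      exact hs fun g hg => (QuotientGroup.eq_one_iff g).1
        (Set.mem_singleton_iff.1 (h ▸ Set.mem_image_of_mem _ hg))
  · rintro _ (⟨_, ⟨M, hM, hs, rfl⟩, rfl⟩ | ⟨_, ⟨⟨M, hM, hs, rfl⟩ | h, hne⟩, rfl⟩)
    · change ((↑) : N → G) '' (((↑) : N → G) ⁻¹' M) ∈ E.classes
      rwa [Set.image_preimage_eq_of_subset (by rwa [Subtype.range_coe])]
    · change ((↑) : G → G ⧸ N) ⁻¹' (((↑) : G → G ⧸ N) '' M) ∈ E.classes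
      rwa [hN.mk_preimage_image hM hs]
    · exact absurd h hne

/-- The condition on superclasses is sufficient for a factorization. In each of the two factors
there are at most as many character parts as superclasses; since the totals agree, equality holds
in both. -/
theorem factorsOver_of_isCompatible (hE : E.IsSupercharacterTheory) (hN : E.IsCompatible N) :
    E.FactorsOver N := by
  have hCX := hE.isPartition_resPair_chars hN
  have hCK := isPartition_resPair_classes hE.classes_partition hN
  have hCσ := hE.sigma_mem_constOn_resPair hN
  have hDX := hE.isPartition_quotPair_chars hN
  have hDK := isPartition_quotPair_classes hE.classes_partition hN
  have hDσ := hE.sigma_mem_constOn_quotPair (N := N)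
  have heq := hE.eq_starProduct_of_isCompatible hN
  have hinv : ∀ X ∈ (E.resPair N).chars, IsConjInvariant X := by
    rintro _ (⟨X, -, -, rfl⟩ | rfl)
    · exact isConjInvariant_constituents X
    · exact fun ψ hψ g => (Irr.conj_mem_trivialIrr_iff g ψ).2 hψ
  have hone : {1} ∈ (E.quotPair N).classes := Or.inr rfl
  -- `h1` and `h2` bound the factors; `h3`, `h4` and `E.card_eq` force equality in both.
  have h1 := ncard_chars_le_ncard_classes hCX hCK hCσ
  have h2 := ncard_chars_le_ncard_classes hDX hDK hDσ
  have h3 := ncard_chars_starProduct (D := E.quotPair N) hCX hinv (Or.inr rfl)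
  have h4 := ncard_classes_starProduct (C := E.resPair N) hDK hone
  rw [← heq] at h3 h4
  have h5 := hE.card_eq
  refine ⟨_, _, ⟨hCX, hCK, ⟨{1}, hE.one_mem, ?_, ?_⟩, by omega, hCσ⟩, ?_,
    ⟨hDX, hDK, hone, by omega, hDσ⟩, heq⟩
  · exact Set.singleton_subset_iff.2 N.one_mem
  · ext n; simp
  · rintro _ ⟨M, hM, -, rfl⟩ g
    have hconj : ∀ (g : G) (n : N), (n : G) ∈ M → ((MulAut.conjNormal g n : N) : G) ∈ M :=
      fun g n hn => by rw [MulAut.conjNormal_apply]; exact hE.conj_mem hM hn g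
    refine Set.Subset.antisymm ?_ fun n hn => ?_
    · rintro _ ⟨n, hn, rfl⟩
      exact hconj g n hn
    · exact ⟨MulAut.conjNormal g⁻¹ n, hconj g⁻¹ n hn, by simp⟩

end PartPair.IsSupercharacterTheory

end Factorization

end Supercharacter

open Supercharacter

theorem mainTheorem3 {G : Type*} [Group G] [Finite G] (N : Subgroup G) [N.Normal]
    (E : PartPair G) (hE : E.IsSupercharacterTheory) :
    (E.FactorsOver N ↔
      E.IsNormalSubgroup N ∧
        ∀ K ∈ E.classes, Disjoint K (N : Set G) → IsUnionOfCosets N K) ∧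
    (E.FactorsOver N ↔ minNormal N ≤ E ∧ E ≤ maxNormal N) ∧
    (∀ (C : PartPair N) (D : PartPair (G ⧸ N)),
      C.IsSupercharacterTheory → C.IsInvariant → D.IsSupercharacterTheory →
        E = C.starProduct D → C = E.restrict N ∧ D = E.quotient N) ∧
    (E.FactorsOver N →
      (E.restrict N).IsSupercharacterTheory ∧ (E.restrict N).IsInvariant ∧
        (E.quotient N).IsSupercharacterTheory ∧
          E = (E.restrict N).starProduct (E.quotient N)) := by
  have hsuff : (E.IsNormalSubgroup N ∧
      ∀ K ∈ E.classes, Disjoint K (N : Set G) → IsUnionOfCosets N K) → E.FactorsOver N :=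
    fun h => hE.factorsOver_of_isCompatible
      ⟨(isNormalSubgroup_iff hE.classes_partition).1 h.1,
        fun K hK hd => isUnionOfCosets_iff.1 (h.2 K hK hd)⟩
  have hle : E.FactorsOver N → minNormal N ≤ E ∧ E ≤ maxNormal N := by
    rintro ⟨C, D, hC, hinv, hD, rfl⟩
    exact ⟨minNormal_le_starProduct hC hinv hD, starProduct_le_maxNormal hC hD⟩
  have hclasses := isNormalSubgroup_and_isUnionOfCosets_of_le (N := N) hE.classes_partition
  have huniq : ∀ (C : PartPair N) (D : PartPair (G ⧸ N)),
      C.IsSupercharacterTheory → C.IsInvariant → D.IsSupercharacterTheory →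
        E = C.starProduct D → C = E.restrict N ∧ D = E.quotient N := by
    rintro C D hC hinv hD rfl
    rw [PartPair.restrict_eq_resPair, PartPair.quotient_eq_quotPair,
      PartPair.join_eq_left hE (minNormal_le_starProduct hC hinv hD)]
    exact ⟨(resPair_starProduct hC hinv hD).symm, (quotPair_starProduct hC hD).symm⟩
  refine ⟨⟨fun h => hclasses (hle h).1 (hle h).2, hsuff⟩,
    ⟨hle, fun h => hsuff (hclasses h.1 h.2)⟩, huniq, ?_⟩
  rintro ⟨C, D, hC, hinv, hD, h⟩
  obtain ⟨hCeq, hDeq⟩ := huniq C D hC hinv hD h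
  rw [← hCeq, ← hDeq]
  exact ⟨hC, hinv, hD, h⟩
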